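/- Let $L\ge 6$ and consider Boolean multireference alignment with uniform shifts and no deletions: given a signal $x\in\mathbb{Z}_2^L$ (with entries $x(j)$, $j\in\mathbb{Z}_L$), one observes $N$ measurements $Y_1,\dots,Y_N\in\mathbb{Z}_2^L$, $$Y_i(j)=x(S_i+j)\oplus Z_i(j),\qquad j\in\mathbb{Z}_L,$$ where the shifts $S_i$ are uniform on $\mathbb{Z}_L$, the entries $Z_i(j)$ are Bernoulli of parameter $p\in(0,1)$, and all of these are independent. Put $\mathrm{SNR}=(p-\tfrac12)^2$. The signal is drawn, independently of the shifts and the noise, from a prior distribution $P_X$ that does not depend on $p$ and $N$ and whose support $\mathcal{X}\subset\mathbb{Z}_2^L$ contains exactly one element of each class of signals modulo cyclic shifts. Let $P_e=P_e(N)$ be the probability of error of the maximum a posteriori (MAP) decoder, i.e. the probability that a maximizer of the posterior probability of the signal given $Y_1,\dots,Y_N$ is not the true signal. Then for every $p\in(0,1)$ one has $P_e>0$, and the error exponent $$E(p)=-\lim_{N\to\infty}\frac1N\log P_e$$ exists, is finite, and depends only on $L$ and $p$ (not on the choice of $\mathcal{X}$ or $P_X$). As $p\to\frac12$, i.e. $\mathrm{SNR}\to0$,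 one has either $$E(p)=\frac{2^{10}}{L}\,\mathrm{SNR}^3+O(\mathrm{SNR}^4)\qquad\text{or}\qquad E(p)=O(\mathrm{SNR}^4).$$ The first case holds whenever $L$ is prime, and the second whenever $L\ge 12$ is even. -/

import Mathlib

open Filter Topology Asymptotics

/-- Boolean signals of length `L`, indexed cyclically: elements of `ℤ₂ ^ L` with index set `ℤ_L`. -/
abbrev Signal (L : ℕ) : Type := ZMod L → ZMod 2

/-- The cyclic shift of `x` by `s`: the signal `j ↦ x (s + j)`. -/
def cyclicShift {L : ℕ} (s : ZMod L) (x : Signal L) : Signal L := fun j => x (s + j)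

/-- `X` contains exactly one element of each class of signals modulo cyclic shifts. -/
def IsShiftTransversal {L : ℕ} (X : Set (Signal L)) : Prop :=
  ∀ x : Signal L, ∃! x' : Signal L, x' ∈ X ∧ ∃ s : ZMod L, x' = cyclicShift s x

/-- The signal-to-noise ratio `(p - 1/2) ^ 2` for the bit-flip probability `p`. -/
noncomputable def snr (p : ℝ) : ℝ := (p - 1 / 2) ^ 2

/-- The probability of the noise vector `z`, whose `L` entries are i.i.d. Bernoulli of
parameter `p`. -/
noncomputable def noiseProb {L : ℕ} [NeZero L] (p : ℝ) (z : Signal L) : ℝ :=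
  ∏ j : ZMod L, if z j = 1 then p else 1 - p

/-- The conditional probability, given the signal `x`, that an observation
`Y(j) = x(S + j) ⊕ Z(j)`, `j ∈ ℤ_L`, equals `y`. Here the shift `S` is uniform on `ℤ_L`, the
noise `Z` has i.i.d. Bernoulli entries of parameter `p`, and `S`, `Z` are independent. -/
noncomputable def obsProb {L : ℕ} [NeZero L] (p : ℝ) (x y : Signal L) : ℝ :=
  ∑ s : ZMod L, ∑ z : Signal L,
    if y = cyclicShift s x + z then (1 / (L : ℝ)) * noiseProb p z else 0

/-- The conditional probability of the `N` measurements `y`, i.i.d. given the signal `x`. -/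
noncomputable def sampleProb {L : ℕ} [NeZero L] (p : ℝ) {N : ℕ} (x : Signal L)
    (y : Fin N → Signal L) : ℝ :=
  ∏ i : Fin N, obsProb p x (y i)

/-- `d` is a maximum a posteriori decoder from `N` measurements for the prior `P`: its value at
`y` maximizes the joint probability `P x * P(y | x)`, hence the posterior probability of `x`
given `y`. Ties are broken arbitrarily. -/
def IsMAPDecoder {L : ℕ} [NeZero L] (P : Signal L → ℝ) (p : ℝ) {N : ℕ}
    (d : (Fin N → Signal L) → Signal L) : Prop :=
  ∀ (y : Fin N → Signal L) (x : Signal L),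
    P x * sampleProb p x y ≤ P (d y) * sampleProb p (d y) y

/-- The probability that the decoder `d` errs, `∑ x, P x * P(d(Y₁, …, Y_N) ≠ x | x)`. -/
noncomputable def errorProb {L : ℕ} [NeZero L] (P : Signal L → ℝ) (p : ℝ) {N : ℕ}
    (d : (Fin N → Signal L) → Signal L) : ℝ :=
  ∑ x : Signal L, P x * ∑ y : Fin N → Signal L, if d y ≠ x then sampleProb p x y else 0

/-- `e` is the error exponent of MAP decoding for the prior `P` and the bit-flip probability `p`:
the error probability `P_e` of MAP decoding from `N` measurements is positive, and
`-(1/N) log P_e` converges to `e` as `N → ∞`. -/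
def IsMAPErrorExponent {L : ℕ} [NeZero L] (P : Signal L → ℝ) (p e : ℝ) : Prop :=
  ∀ d : (N : ℕ) → (Fin N → Signal L) → Signal L, (∀ N, IsMAPDecoder P p (d N)) →
    (∀ N, 0 < errorProb P p (d N)) ∧
    Tendsto (fun N : ℕ => -((1 / (N : ℝ)) * Real.log (errorProb P p (d N)))) atTop (𝓝 e)

/-- `E(p) = (2 ^ 10 / L) SNR ^ 3 + O(SNR ^ 4)` as `p → 1/2`. -/
def CubicExponent (L : ℕ) (E : ℝ → ℝ) : Prop :=
  (fun p : ℝ => E p - 2 ^ 10 / (L : ℝ) * snr p ^ 3) =O[𝓝 (1 / 2)] fun p : ℝ => snr p ^ 4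

/-- `E(p) = O(SNR ^ 4)` as `p → 1/2`. -/
def QuarticExponent (E : ℝ → ℝ) : Prop :=
  E =O[𝓝 (1 / 2)] fun p : ℝ => snr p ^ 4

/-! For finitely many hypotheses the MAP error is squeezed, up to factors subexponential in N,
between the error of any one pair and a union bound over pairs. The exponent is therefore the least
Chernoff information over pairs of inequivalent signals (`mapExponent`). The prior enters only
through constants, and the representatives do not matter because a uniform shift makes the
observation law a function of the shift class.

Put t = 1 - 2p, so that t² = 4 SNR. In the Walsh basis the law of an observation has coefficients
t^|A| times the autocorrelation `moment A x`. If two signals have the same moments of order below k,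
a second-order expansion of the Bhattacharyya affinity (`affinity_half_le`, `le_affinity_half`)
gives the distance (4 SNR)^k * `momentGap k` / 8 + O(SNR^(k+1)); parity of Walsh products removes
the odd power of t that would spoil the error term.

At the first order k where they differ, moment differences are (-2)^k / L times integers, the
`countGap`s. Shift invariance forces the positive and the negative gaps each to have a sum of
squares at least L, so for k = 3 the gap is at least 64 * 2L / L² = 128 / L, and 64 / 8 * 128 / L =
2^10 / L. The indicator of {0, 1, 3} and its mirror image attain this: reflection preserves moments
of order at most 2, and by symmetry the Chernoff information of a mirror pair is exactly its
Bhattacharyya distance.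

Hence the cubic law holds unless some inequivalent pair shares all moments of order at most 3, in
which case the exponent is O(SNR^4). For prime L no such pair exists: irreducibility of the
cyclotomic polynomial keeps the Fourier transform of a nonconstant signal away from zero, so the
bispectrum determines the class. For even L ≥ 12 a chiral antiperiodic signal and its mirror image
form such a pair, since all their odd moments vanish. -/

/-! ### Chernoff information and the converse bound -/

section Chernoff

variable {α : Type*} [Fintype α]

/-- The Chernoff `t`-affinity of two distributions on a finite set. -/
noncomputable def affinity (P Q : α → ℝ) (t : ℝ) : ℝ := ∑ y, P y ^ (1 - t) * Q y ^ t

/-- The Chernoff coefficient, the least affinity over `t ∈ [0, 1]`; minus its logarithm is the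
Chernoff information. -/
noncomputable def chernoffCoeff (P Q : α → ℝ) : ℝ := sInf (affinity P Q '' Set.Icc 0 1)

theorem rpow_mul_rpow_eq_exp {a b : ℝ} (ha : 0 < a) (hb : 0 < b) (t : ℝ) :
    a ^ (1 - t) * b ^ t = Real.exp (Real.log a + t * (Real.log b - Real.log a)) := by
  rw [Real.rpow_def_of_pos ha, Real.rpow_def_of_pos hb, ← Real.exp_add]
  congr 1; ring

variable {P Q : α → ℝ}

theorem affinity_pos [Nonempty α] (hP : ∀ y, 0 < P y) (hQ : ∀ y, 0 < Q y) (t : ℝ) :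
    0 < affinity P Q t :=
  Finset.sum_pos (fun y _ => mul_pos (Real.rpow_pos_of_pos (hP y) _)
    (Real.rpow_pos_of_pos (hQ y) _)) Finset.univ_nonempty

theorem affinity_le_one (hP : ∀ y, 0 < P y) (hQ : ∀ y, 0 < Q y) (hP1 : ∑ y, P y = 1)
    (hQ1 : ∑ y, Q y = 1) {t : ℝ} (ht : t ∈ Set.Icc (0 : ℝ) 1) : affinity P Q t ≤ 1 := by
  calc affinity P Q t ≤ ∑ y, ((1 - t) * P y + t * Q y) :=
        Finset.sum_le_sum fun y _ => Real.geom_mean_le_arith_mean2_weighted (by linarith [ht.2])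
          ht.1 (hP y).le (hQ y).le (by ring)
    _ = 1 := by rw [Finset.sum_add_distrib, ← Finset.mul_sum, ← Finset.mul_sum, hP1, hQ1]; ring

theorem affinity_zero (hP1 : ∑ y, P y = 1) : affinity P Q 0 = 1 := by
  simp [affinity, hP1]

theorem affinity_one (hQ1 : ∑ y, Q y = 1) : affinity P Q 1 = 1 := by
  simp [affinity, hQ1]

theorem hasDerivAt_affinity (hP : ∀ y, 0 < P y) (hQ : ∀ y, 0 < Q y) (t : ℝ) :
    HasDerivAt (affinity P Q)
      (∑ y, P y ^ (1 - t) * Q y ^ t * (Real.log (Q y) - Real.log (P y))) t := by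
  have h : affinity P Q = fun t => ∑ y, Real.exp (Real.log (P y) +
      t * (Real.log (Q y) - Real.log (P y))) := by
    funext t
    exact Finset.sum_congr rfl fun y _ => rpow_mul_rpow_eq_exp (hP y) (hQ y) t
  rw [h]
  apply HasDerivAt.fun_sum
  intro y _
  rw [rpow_mul_rpow_eq_exp (hP y) (hQ y)]
  have := ((((hasDerivAt_id t).mul_const
    (Real.log (Q y) - Real.log (P y))).const_add (Real.log (P y))).exp)
  simpa using this

/-- The affinity is 1 at both ends and at most 1 between, so a minimizer can be taken in the open
interval; if the minimum is 1, the point 1/2 serves. The derivative vanishes there, which says that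
the log-likelihood ratio has mean zero under the tilted law. -/
theorem exists_critical_affinity (hP : ∀ y, 0 < P y) (hQ : ∀ y, 0 < Q y) (hP1 : ∑ y, P y = 1)
    (hQ1 : ∑ y, Q y = 1) :
    ∃ t ∈ Set.Ioo (0 : ℝ) 1, chernoffCoeff P Q = affinity P Q t ∧
      ∑ y, P y ^ (1 - t) * Q y ^ t * (Real.log (Q y) - Real.log (P y)) = 0 := by
  have hcont : Continuous (affinity P Q) :=
    continuous_iff_continuousAt.2 fun t => (hasDerivAt_affinity hP hQ t).continuousAt
  have key : ∃ t ∈ Set.Ioo (0 : ℝ) 1, ∀ u ∈ Set.Icc (0 : ℝ) 1, affinity P Q t ≤ affinity P Q u := by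
    obtain ⟨t, ht, hmin⟩ := isCompact_Icc.exists_isMinOn (Set.nonempty_Icc.2 zero_le_one)
      (hcont.continuousOn (s := Set.Icc (0 : ℝ) 1))
    by_cases h : affinity P Q t = 1
    · refine ⟨1 / 2, by norm_num, fun u hu => ?_⟩
      exact (affinity_le_one hP hQ hP1 hQ1 (by norm_num)).trans (h ▸ hmin hu)
    · refine ⟨t, ⟨lt_of_le_of_ne ht.1 ?_, lt_of_le_of_ne ht.2 ?_⟩, fun u hu => hmin hu⟩
      · rintro rfl; exact h (affinity_zero hP1)
      · rintro rfl; exact h (affinity_one hQ1)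
  obtain ⟨t, ht, hmin⟩ := key
  refine ⟨t, ht, ?_, ?_⟩
  · refine IsLeast.csInf_eq ⟨⟨t, Set.Ioo_subset_Icc_self ht, rfl⟩, ?_⟩
    rintro _ ⟨u, hu, rfl⟩
    exact hmin u hu
  · refine IsLocalMin.hasDerivAt_eq_zero ?_ (hasDerivAt_affinity hP hQ t)
    filter_upwards [Ioo_mem_nhds ht.1 ht.2] with u hu
    exact hmin u (Set.Ioo_subset_Icc_self hu)

theorem chernoffCoeff_le (hP : ∀ y, 0 < P y) (hQ : ∀ y, 0 < Q y) {t : ℝ}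
    (ht : t ∈ Set.Icc (0 : ℝ) 1) : chernoffCoeff P Q ≤ affinity P Q t := by
  refine csInf_le ⟨0, ?_⟩ ⟨t, ht, rfl⟩
  rintro _ ⟨u, -, rfl⟩
  exact Finset.sum_nonneg fun y _ => mul_nonneg (Real.rpow_nonneg (hP y).le _)
    (Real.rpow_nonneg (hQ y).le _)

theorem chernoffCoeff_pos [Nonempty α] (hP : ∀ y, 0 < P y) (hQ : ∀ y, 0 < Q y)
    (hP1 : ∑ y, P y = 1) (hQ1 : ∑ y, Q y = 1) : 0 < chernoffCoeff P Q := by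
  obtain ⟨t, -, h, -⟩ := exists_critical_affinity hP hQ hP1 hQ1
  exact h ▸ affinity_pos hP hQ t

/-- Cauchy-Schwarz: the summands at t and 1 - t multiply to the square of the summand at 1/2. -/
theorem affinity_half_sq_le (hP : ∀ y, 0 < P y) (hQ : ∀ y, 0 < Q y) (t : ℝ) :
    affinity P Q (1 / 2) ^ 2 ≤ affinity P Q t * affinity P Q (1 - t) := by
  refine Finset.sum_sq_le_sum_mul_sum_of_sq_le_mul _ (fun y _ => ?_) (fun y _ => ?_)
    (fun y _ => ?_)
  · exact mul_nonneg (Real.rpow_nonneg (hP y).le _) (Real.rpow_nonneg (hQ y).le _)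
  · exact mul_nonneg (Real.rpow_nonneg (hP y).le _) (Real.rpow_nonneg (hQ y).le _)
  · refine le_of_eq ?_
    simp only [rpow_mul_rpow_eq_exp (hP y) (hQ y), ← Real.exp_add, pow_two]
    congr 1; ring

/-- Bounding the affinity at 1 - t by 1 costs at most a factor two in the exponent, harmless when
only the order of magnitude matters. -/
theorem affinity_half_sq_le_chernoffCoeff (hP : ∀ y, 0 < P y) (hQ : ∀ y, 0 < Q y)
    (hP1 : ∑ y, P y = 1) (hQ1 : ∑ y, Q y = 1) :
    affinity P Q (1 / 2) ^ 2 ≤ chernoffCoeff P Q := by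
  obtain ⟨t, ht, h, -⟩ := exists_critical_affinity hP hQ hP1 hQ1
  rw [h]
  have h1 := affinity_half_sq_le hP hQ t
  have h2 := affinity_le_one hP hQ hP1 hQ1 (t := 1 - t) ⟨by linarith [ht.2], by linarith [ht.1]⟩
  have h3 : 0 ≤ affinity P Q t := Finset.sum_nonneg fun y _ =>
    mul_nonneg (Real.rpow_nonneg (hP y).le _) (Real.rpow_nonneg (hQ y).le _)
  nlinarith

/-- A bijection exchanging the two laws makes the affinity symmetric about 1/2, so Cauchy-Schwarz
loses nothing. -/
theorem affinity_half_le_chernoffCoeff_of_equiv (hP : ∀ y, 0 < P y) (hQ : ∀ y, 0 < Q y)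
    (hP1 : ∑ y, P y = 1) (hQ1 : ∑ y, Q y = 1) (e : α ≃ α) (hPe : ∀ y, P (e y) = Q y)
    (hQe : ∀ y, Q (e y) = P y) : affinity P Q (1 / 2) ≤ chernoffCoeff P Q := by
  obtain ⟨t, -, h, -⟩ := exists_critical_affinity hP hQ hP1 hQ1
  have h3 : 0 ≤ affinity P Q t := Finset.sum_nonneg fun y _ =>
    mul_nonneg (Real.rpow_nonneg (hP y).le _) (Real.rpow_nonneg (hQ y).le _)
  have hsymm : affinity P Q (1 - t) = affinity P Q t := by
    unfold affinity
    rw [← e.sum_comp]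
    refine Finset.sum_congr rfl fun y _ => ?_
    rw [hPe, hQe, mul_comm, sub_sub_cancel]
  have h1 := affinity_half_sq_le hP hQ t
  rw [hsymm, ← pow_two] at h1
  rw [h]
  exact le_of_sq_le_sq h1 h3

/-- The variance of a sum of independent centred variables is additive; centring kills the cross
term. -/
theorem sum_prod_mul_sum_sq {R l : α → ℝ} (hR : ∑ y, R y = 1) (hl : ∑ y, R y * l y = 0) (N : ℕ) :
    ∑ y : Fin N → α, (∏ i, R (y i)) * (∑ i, l (y i)) ^ 2 = N * ∑ y, R y * l y ^ 2 := by
  have h0 : ∀ N : ℕ, ∑ y : Fin N → α, ∏ i, R (y i) = 1 := fun N => by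
    rw [← Fintype.sum_pow, hR, one_pow]
  induction N with
  | zero => simp
  | succ N ih =>
    rw [← (Fin.consEquiv fun _ => α).sum_comp, Fintype.sum_prod_type]
    simp only [Fin.consEquiv_apply, Fin.prod_univ_succ, Fin.sum_univ_succ, Fin.cons_zero,
      Fin.cons_succ]
    have : ∀ a : α, ∀ y : Fin N → α, R a * (∏ i, R (y i)) * (l a + ∑ i, l (y i)) ^ 2 =
        R a * l a ^ 2 * (∏ i, R (y i)) + 2 * (R a * l a) * ((∏ i, R (y i)) * ∑ i, l (y i)) +
        R a * ((∏ i, R (y i)) * (∑ i, l (y i)) ^ 2) := fun a y => by ring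
    simp only [this, Finset.sum_add_distrib, ← Finset.mul_sum, ← Finset.sum_mul, ih, h0, hR, hl]
    push_cast; ring

theorem exp_neg_mul_le_min {a b t : ℝ} (ha : 0 < a) (hb : 0 < b) (ht : t ∈ Set.Icc (0 : ℝ) 1) :
    a ^ (1 - t) * b ^ t * Real.exp (-|Real.log b - Real.log a|) ≤ min a b := by
  rw [rpow_mul_rpow_eq_exp ha hb, ← Real.exp_add]
  have h1 := neg_abs_le (Real.log b - Real.log a)
  have h2 := le_abs_self (Real.log b - Real.log a)
  have h3 := abs_nonneg (Real.log b - Real.log a)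
  refine le_min ?_ ?_
  · conv_rhs => rw [← Real.exp_log ha]
    refine Real.exp_le_exp.2 ?_
    nlinarith [ht.1, ht.2]
  · conv_rhs => rw [← Real.exp_log hb]
    refine Real.exp_le_exp.2 ?_
    nlinarith [ht.1, ht.2]

/-- Chebyshev's inequality in pointwise form. -/
theorem exp_neg_mul_one_sub_le {a s : ℝ} (ha : 0 < a) :
    Real.exp (-a) * (1 - s ^ 2 / a ^ 2) ≤ Real.exp (-|s|) := by
  rcases le_total |s| a with h | h
  · calc _ ≤ Real.exp (-a) * 1 := by gcongr; linarith [div_nonneg (sq_nonneg s) (sq_nonneg a)]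
      _ ≤ _ := by rw [mul_one]; gcongr
  · have : 1 ≤ s ^ 2 / a ^ 2 := by
      rw [le_div_iff₀ (by positivity), one_mul, ← sq_abs s]; gcongr
    exact (mul_nonpos_of_nonneg_of_nonpos (Real.exp_pos _).le (by linarith)).trans
      (Real.exp_pos _).le

/-- The converse part of the Chernoff bound. -/
theorem exists_le_sum_min [Nonempty α] (hP : ∀ y, 0 < P y) (hQ : ∀ y, 0 < Q y)
    (hP1 : ∑ y, P y = 1) (hQ1 : ∑ y, Q y = 1) :
    ∃ V > 0, ∀ N : ℕ, 0 < N → chernoffCoeff P Q ^ N * (1 / 2 * Real.exp (-√(V * N))) ≤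
      ∑ y : Fin N → α, min (∏ i, P (y i)) (∏ i, Q (y i)) := by
  obtain ⟨t, ht, hc, hcrit⟩ := exists_critical_affinity hP hQ hP1 hQ1
  set g := affinity P Q t with hg
  have hgpos : 0 < g := affinity_pos hP hQ t
  -- Change of measure to the tilted law `R`, under which the log-likelihood ratio `l` is centred.
  -- Over N samples its sum is typically of size √N, and there the minimum of the two likelihoods is
  -- at least g^N times the tilted weight, up to exp(-O(√N)).
  set R : α → ℝ := fun y => P y ^ (1 - t) * Q y ^ t / g with hR
  set l : α → ℝ := fun y => Real.log (Q y) - Real.log (P y) with hl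
  have hRpos : ∀ y, 0 < R y := fun y =>
    div_pos (mul_pos (Real.rpow_pos_of_pos (hP y) _) (Real.rpow_pos_of_pos (hQ y) _)) hgpos
  have hR1 : ∑ y, R y = 1 := by
    simp only [hR, ← Finset.sum_div]
    exact div_self hgpos.ne'
  have hRl : ∑ y, R y * l y = 0 := by
    simp only [hR, div_mul_eq_mul_div, ← Finset.sum_div]
    rw [hcrit, zero_div]
  set W := ∑ y, R y * l y ^ 2 with hW
  have hW0 : 0 ≤ W := Finset.sum_nonneg fun y _ => mul_nonneg (hRpos y).le (sq_nonneg _)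
  -- The variance is N * W, so a² = (2W + 1) * N bounds the Chebyshev loss by 1/2; the summand 1
  -- keeps a positive when W = 0.
  refine ⟨2 * W + 1, by positivity, fun N hN => ?_⟩
  have hN' : (0 : ℝ) < N := by exact_mod_cast hN
  set a := √((2 * W + 1) * N) with ha
  have hapos : 0 < a := Real.sqrt_pos.2 (by positivity)
  have hasq : a ^ 2 = (2 * W + 1) * N := Real.sq_sqrt (by positivity)
  have hpt : ∀ y : Fin N → α, g ^ N * ((∏ i, R (y i)) *
      (Real.exp (-a) * (1 - (∑ i, l (y i)) ^ 2 / a ^ 2))) ≤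
      min (∏ i, P (y i)) (∏ i, Q (y i)) := fun y => by
    have hpp : 0 < ∏ i, P (y i) := Finset.prod_pos fun i _ => hP _
    have hqq : 0 < ∏ i, Q (y i) := Finset.prod_pos fun i _ => hQ _
    have h1 := exp_neg_mul_le_min hpp hqq (Set.Ioo_subset_Icc_self ht)
    have h2 : (∏ i, P (y i)) ^ (1 - t) * (∏ i, Q (y i)) ^ t = g ^ N * ∏ i, R (y i) := by
      rw [← Real.finsetProd_rpow _ _ fun i _ => (hP _).le,
        ← Real.finsetProd_rpow _ _ fun i _ => (hQ _).le, ← Finset.prod_mul_distrib]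
      simp only [hR, Finset.prod_div_distrib, Finset.prod_const, Finset.card_univ,
        Fintype.card_fin]
      field_simp
    have h3 : Real.log (∏ i, Q (y i)) - Real.log (∏ i, P (y i)) = ∑ i, l (y i) := by
      rw [Real.log_prod fun i _ => (hQ _).ne', Real.log_prod fun i _ => (hP _).ne',
        ← Finset.sum_sub_distrib]
    rw [h2, h3] at h1
    refine le_trans ?_ h1
    rw [mul_assoc]
    have : 0 ≤ ∏ i, R (y i) := Finset.prod_nonneg fun i _ => (hRpos _).le
    gcongr
    exact exp_neg_mul_one_sub_le hapos
  refine le_trans ?_ (Finset.sum_le_sum fun y _ => hpt y)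
  rw [← Finset.mul_sum, hc]
  refine mul_le_mul_of_nonneg_left ?_ (by positivity)
  have : ∀ y : Fin N → α, (∏ i, R (y i)) *
      (Real.exp (-a) * (1 - (∑ i, l (y i)) ^ 2 / a ^ 2)) = Real.exp (-a) * (∏ i, R (y i)) -
      Real.exp (-a) / a ^ 2 * ((∏ i, R (y i)) * (∑ i, l (y i)) ^ 2) := fun y => by ring
  simp only [this, Finset.sum_sub_distrib, ← Finset.mul_sum, sum_prod_mul_sum_sq hR1 hRl]
  rw [← Fintype.sum_pow, hR1, one_pow, hasq, ← hW]
  have h4 : (N * W) / ((2 * W + 1) * N) ≤ 1 / 2 := by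
    rw [div_le_div_iff₀ (by positivity) (by norm_num)]; nlinarith
  have h5 : Real.exp (-a) / ((2 * W + 1) * N) * (N * W) =
      Real.exp (-a) * ((N * W) / ((2 * W + 1) * N)) := by ring
  rw [h5]
  nlinarith [Real.exp_pos (-a)]

end Chernoff

/-! ### The law of one observation -/

section Observations

variable {L : ℕ} [NeZero L] {p : ℝ}

theorem noiseProb_pos (hp0 : 0 < p) (hp1 : p < 1) (z : Signal L) : 0 < noiseProb p z :=
  Finset.prod_pos fun j _ => by split_ifs <;> linarith

theorem sum_noiseProb (p : ℝ) : ∑ z : Signal L, noiseProb p z = 1 := by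
  unfold noiseProb
  rw [← Fintype.prod_sum (fun (_ : ZMod L) (b : ZMod 2) => if b = 1 then p else 1 - p)]
  refine Finset.prod_eq_one fun j _ => ?_
  have : ∑ b : ZMod 2, (if b = 1 then p else 1 - p) =
    (if (0 : ZMod 2) = 1 then p else 1 - p) + (if (1 : ZMod 2) = 1 then p else 1 - p) :=
    Fin.sum_univ_two _
  rw [this]
  simp

theorem obsProb_eq (p : ℝ) (x y : Signal L) :
    obsProb p x y = 1 / (L : ℝ) * ∑ s : ZMod L, noiseProb p (y - cyclicShift s x) := by
  unfold obsProb
  rw [Finset.mul_sum]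
  refine Finset.sum_congr rfl fun s _ => ?_
  rw [Finset.sum_eq_single (y - cyclicShift s x)]
  · simp
  · intro z _ hz
    rw [if_neg]
    rintro rfl
    simp at hz
  · simp

theorem obsProb_pos (hp0 : 0 < p) (hp1 : p < 1) (x y : Signal L) : 0 < obsProb p x y := by
  rw [obsProb_eq]
  have : (0 : ℝ) < L := by exact_mod_cast NeZero.pos L
  exact mul_pos (by positivity) (Finset.sum_pos (fun s _ => noiseProb_pos hp0 hp1 _)
    Finset.univ_nonempty)

theorem sum_obsProb (p : ℝ) (x : Signal L) : ∑ y, obsProb p x y = 1 := by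
  simp only [obsProb_eq]
  rw [← Finset.mul_sum, Finset.sum_comm]
  have : ∀ s : ZMod L, ∑ y, noiseProb p (y - cyclicShift s x) = 1 := fun s => by
    rw [← sum_noiseProb (L := L) p]
    exact (Equiv.subRight (cyclicShift s x)).sum_comp (noiseProb p)
  simp only [this]
  have : (L : ℝ) ≠ 0 := by exact_mod_cast NeZero.ne L
  simp [ZMod.card, this]

omit [NeZero L] in
theorem cyclicShift_cyclicShift (s t : ZMod L) (x : Signal L) :
    cyclicShift s (cyclicShift t x) = cyclicShift (t + s) x := by
  funext j; simp [cyclicShift, add_assoc]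

omit [NeZero L] in
theorem cyclicShift_zero (x : Signal L) : cyclicShift 0 x = x := by
  funext j; simp [cyclicShift]

/-- The uniform random shift absorbs any fixed one. -/
theorem obsProb_cyclicShift (p : ℝ) (t : ZMod L) (x : Signal L) :
    obsProb p (cyclicShift t x) = obsProb p x := by
  funext y
  simp only [obsProb_eq, cyclicShift_cyclicShift]
  rw [← Equiv.sum_comp (Equiv.addLeft t) (fun s => noiseProb p (y - cyclicShift s x))]
  rfl

theorem sampleProb_pos (hp0 : 0 < p) (hp1 : p < 1) {N : ℕ} (x : Signal L)
    (y : Fin N → Signal L) : 0 < sampleProb p x y :=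
  Finset.prod_pos fun _ _ => obsProb_pos hp0 hp1 _ _

end Observations

/-! ### The MAP error exponent as a minimum of Chernoff informations -/

section MAPExponent

variable {L : ℕ} [NeZero L]

open Classical in
/-- The pairs of signals that are not cyclic shifts of each other. -/
noncomputable def inequivPairs (L : ℕ) [NeZero L] : Finset (Signal L × Signal L) :=
  Finset.univ.filter fun q => ∀ s : ZMod L, q.2 ≠ cyclicShift s q.1

theorem mem_inequivPairs {q : Signal L × Signal L} :
    q ∈ inequivPairs L ↔ ∀ s : ZMod L, q.2 ≠ cyclicShift s q.1 := by
  simp [inequivPairs]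

theorem inequivPairs_nonempty : (inequivPairs L).Nonempty :=
  ⟨(0, 1), mem_inequivPairs.2 fun s h => by simpa [cyclicShift] using congrFun h 0⟩

/-- The Chernoff information between the observation distributions of two signals. -/
noncomputable def pairInformation (p : ℝ) (q : Signal L × Signal L) : ℝ :=
  -Real.log (chernoffCoeff (obsProb p q.1) (obsProb p q.2))

/-- The least Chernoff information between signals in distinct shift classes. -/
noncomputable def mapExponent (L : ℕ) [NeZero L] (p : ℝ) : ℝ :=
  (inequivPairs L).inf' inequivPairs_nonempty (pairInformation p)

theorem mapExponent_le {p : ℝ} {q : Signal L × Signal L} (hq : q ∈ inequivPairs L) :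
    mapExponent L p ≤ pairInformation p q :=
  Finset.inf'_le _ hq

theorem exists_mapExponent_eq (L : ℕ) [NeZero L] (p : ℝ) :
    ∃ q ∈ inequivPairs L, mapExponent L p = pairInformation p q :=
  Finset.exists_mem_eq_inf' inequivPairs_nonempty (pairInformation p)

variable {X : Set (Signal L)} {P : Signal L → ℝ} {p : ℝ} {N : ℕ}
  {d : (Fin N → Signal L) → Signal L}

theorem IsShiftTransversal.mem_inequivPairs (hX : IsShiftTransversal X) {x x' : Signal L}
    (hx : x ∈ X) (hx' : x' ∈ X) (h : x ≠ x') : (x, x') ∈ inequivPairs L := by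
  refine _root_.mem_inequivPairs.2 fun s hs => h ?_
  obtain ⟨z, -, hz⟩ := hX x
  rw [hz x ⟨hx, 0, (cyclicShift_zero x).symm⟩, hz x' ⟨hx', s, hs⟩]

/-- Every inequivalent pair is represented inside the transversal with the same observation laws, so
the minimum over all pairs is attained there. -/
theorem IsShiftTransversal.exists_pair (hX : IsShiftTransversal X) {q : Signal L × Signal L}
    (hq : q ∈ inequivPairs L) (p : ℝ) : ∃ x ∈ X, ∃ x' ∈ X, x ≠ x' ∧
      obsProb p x = obsProb p q.1 ∧ obsProb p x' = obsProb p q.2 := by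
  obtain ⟨x, ⟨hx, s, hs⟩, -⟩ := hX q.1
  obtain ⟨x', ⟨hx', t, ht⟩, -⟩ := hX q.2
  refine ⟨x, hx, x', hx', fun h => ?_, by rw [hs, obsProb_cyclicShift],
    by rw [ht, obsProb_cyclicShift]⟩
  refine _root_.mem_inequivPairs.1 hq (s - t) ?_
  have : cyclicShift (-t) (cyclicShift t q.2) = cyclicShift (-t) (cyclicShift s q.1) := by
    rw [← hs, ← ht, h]
  rwa [cyclicShift_cyclicShift, cyclicShift_cyclicShift, add_neg_cancel, cyclicShift_zero,
    ← sub_eq_add_neg] at this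

theorem errorProb_eq (P : Signal L → ℝ) (p : ℝ) (d : (Fin N → Signal L) → Signal L) :
    errorProb P p d =
      ∑ y : Fin N → Signal L, ∑ x, if d y ≠ x then P x * sampleProb p x y else 0 := by
  unfold errorProb
  rw [Finset.sum_comm]
  refine Finset.sum_congr rfl fun x _ => ?_
  rw [Finset.mul_sum]
  refine Finset.sum_congr rfl fun y _ => ?_
  split_ifs <;> simp

/-- Any decoder, MAP or not, misses at least one of `x`, `x'` on each sample. -/
theorem sum_min_le_errorProb (hP : ∀ x, 0 ≤ P x) (hp0 : 0 < p) (hp1 : p < 1) {x x' : Signal L}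
    (h : x ≠ x') : min (P x) (P x') * ∑ y : Fin N → Signal L,
      min (∏ i, obsProb p x (y i)) (∏ i, obsProb p x' (y i)) ≤ errorProb P p d := by
  rw [errorProb_eq, Finset.mul_sum]
  refine Finset.sum_le_sum fun y _ => ?_
  have hs : ∀ z, 0 ≤ sampleProb p z y := fun z => (sampleProb_pos hp0 hp1 z y).le
  have hnn : ∀ z ∈ Finset.univ, 0 ≤ if d y ≠ z then P z * sampleProb p z y else 0 :=
    fun z _ => by split_ifs; exacts [mul_nonneg (hP z) (hs z), le_rfl]
  have key : ∀ z, d y ≠ z → P z * sampleProb p z y ≤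
      ∑ z, if d y ≠ z then P z * sampleProb p z y else 0 := fun z hz => by
    simpa only [if_pos hz] using Finset.single_le_sum hnn (Finset.mem_univ z)
  by_cases hx : d y = x
  · refine le_trans ?_ (key x' (hx ▸ h))
    exact mul_le_mul (min_le_right _ _) (min_le_right _ _) (le_min (hs x) (hs x')) (hP x')
  · refine le_trans ?_ (key x hx)
    exact mul_le_mul (min_le_left _ _) (min_le_left _ _) (le_min (hs x) (hs x')) (hP x)

theorem exp_neg_pairInformation (hp0 : 0 < p) (hp1 : p < 1) (q : Signal L × Signal L) :
    Real.exp (-pairInformation p q) = chernoffCoeff (obsProb p q.1) (obsProb p q.2) := by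
  rw [pairInformation, neg_neg, Real.exp_log]
  exact chernoffCoeff_pos (obsProb_pos hp0 hp1 _) (obsProb_pos hp0 hp1 _) (sum_obsProb p _)
    (sum_obsProb p _)

/-- The pairwise Chernoff bound for a decoder that prefers `x'` to `x`. -/
theorem sum_rpow_sampleProb_le (hp0 : 0 < p) (hp1 : p < 1) {q : Signal L × Signal L}
    (hq : q ∈ inequivPairs L) : ∃ t ∈ Set.Icc (0 : ℝ) 1,
      ∑ y : Fin N → Signal L, sampleProb p q.1 y ^ (1 - t) * sampleProb p q.2 y ^ t ≤
        Real.exp (-mapExponent L p) ^ N := by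
  obtain ⟨t, ht, hc, -⟩ := exists_critical_affinity (obsProb_pos hp0 hp1 q.1)
    (obsProb_pos hp0 hp1 q.2) (sum_obsProb p _) (sum_obsProb p _)
  refine ⟨t, Set.Ioo_subset_Icc_self ht, ?_⟩
  calc _ = affinity (obsProb p q.1) (obsProb p q.2) t ^ N := by
        rw [affinity, Fintype.sum_pow]
        refine Finset.sum_congr rfl fun y _ => ?_
        rw [Finset.prod_mul_distrib, sampleProb, sampleProb,
          Real.finsetProd_rpow _ _ fun i _ => (obsProb_pos hp0 hp1 _ _).le,
          Real.finsetProd_rpow _ _ fun i _ => (obsProb_pos hp0 hp1 _ _).le]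
    _ = Real.exp (-pairInformation p q) ^ N := by rw [exp_neg_pairInformation hp0 hp1, hc]
    _ ≤ _ := by gcongr; exact mapExponent_le hq

/-- Union bound over pairs. When `x` is rejected for `d y`, its joint weight is at most that of `d
y`; splitting the weight of `x` into powers 1 - t and t and applying this to the second yields the
affinity summand, priors being at most 1. -/
theorem errorProb_le (hX : IsShiftTransversal X) (hP : P ∈ stdSimplex ℝ (Signal L))
    (hPX : Function.support P = X) (hp0 : 0 < p) (hp1 : p < 1) (hd : IsMAPDecoder P p d) :
    errorProb P p d ≤
      (Fintype.card (Signal L) : ℝ) ^ 2 * Real.exp (-mapExponent L p) ^ N := by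
  classical
  have hPle : ∀ x, P x ≤ 1 := fun x =>
    hP.2 ▸ Finset.single_le_sum (fun z _ => hP.1 z) (Finset.mem_univ x)
  have hmem : ∀ x, 0 < P x → x ∈ X := fun x hx => hPX ▸ Function.mem_support.2 hx.ne'
  -- A decoded signal of zero prior would force every prior weight to vanish. So `d y` lies in the
  -- transversal and is inequivalent to any other signal there.
  have hdpos : ∀ y, 0 < P (d y) := fun y => by
    by_contra hcon
    have h0 : P (d y) = 0 := le_antisymm (not_lt.1 hcon) (hP.1 _)
    have : ∀ x, P x = 0 := fun x => by
      have h1 := hd y x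
      rw [h0, zero_mul] at h1
      exact le_antisymm (nonpos_of_mul_nonpos_left h1 (sampleProb_pos hp0 hp1 x y)) (hP.1 x)
    have h2 := hP.2
    simp [this] at h2
  choose! t ht hsum using fun q (hq : q ∈ inequivPairs L) =>
    sum_rpow_sampleProb_le (N := N) hp0 hp1 hq
  set F : Signal L × Signal L → (Fin N → Signal L) → ℝ := fun q y =>
    sampleProb p q.1 y ^ (1 - t q) * sampleProb p q.2 y ^ t q with hF
  have hFnn : ∀ q y, 0 ≤ F q y := fun q y => mul_nonneg
    (Real.rpow_nonneg (sampleProb_pos hp0 hp1 _ _).le _)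
    (Real.rpow_nonneg (sampleProb_pos hp0 hp1 _ _).le _)
  have hpt : ∀ y x, (if d y ≠ x then P x * sampleProb p x y else 0) ≤
      ∑ x', if (x, x') ∈ inequivPairs L then F (x, x') y else 0 := fun y x => by
    have hnn : ∀ x' ∈ Finset.univ, 0 ≤ if (x, x') ∈ inequivPairs L then F (x, x') y else 0 :=
      fun x' _ => by split_ifs; exacts [hFnn _ _, le_rfl]
    split_ifs with hne
    swap
    · exact Finset.sum_nonneg hnn
    rcases (hP.1 x).eq_or_lt with h0 | h0
    · rw [← h0, zero_mul]; exact Finset.sum_nonneg hnn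
    have hq := hX.mem_inequivPairs (hmem x h0) (hmem _ (hdpos y)) (Ne.symm hne)
    refine le_trans ?_ (Finset.single_le_sum hnn (Finset.mem_univ (d y)))
    rw [if_pos hq]
    have ha : 0 < P x * sampleProb p x y := mul_pos h0 (sampleProb_pos hp0 hp1 _ _)
    have ht' := ht _ hq
    calc P x * sampleProb p x y
        = (P x * sampleProb p x y) ^ (1 - t (x, d y)) * (P x * sampleProb p x y) ^ t (x, d y) := by
          rw [← Real.rpow_add ha, sub_add_cancel, Real.rpow_one]
      _ ≤ sampleProb p x y ^ (1 - t (x, d y)) * sampleProb p (d y) y ^ t (x, d y) := by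
          have h1 := (sampleProb_pos hp0 hp1 x y).le
          have h2 := (sampleProb_pos hp0 hp1 (d y) y).le
          refine mul_le_mul (Real.rpow_le_rpow ha.le ?_ (by linarith [ht'.2]))
            (Real.rpow_le_rpow ha.le ?_ ht'.1) (Real.rpow_nonneg ha.le _) (Real.rpow_nonneg h1 _)
          · exact mul_le_of_le_one_left h1 (hPle x)
          · exact (hd y x).trans (mul_le_of_le_one_left h2 (hPle _))
  rw [errorProb_eq]
  calc _ ≤ ∑ y : Fin N → Signal L, ∑ x, ∑ x',
        (if (x, x') ∈ inequivPairs L then F (x, x') y else 0) :=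
        Finset.sum_le_sum fun y _ => Finset.sum_le_sum fun x _ => hpt y x
    _ = ∑ x, ∑ x', ∑ y, (if (x, x') ∈ inequivPairs L then F (x, x') y else 0) := by
        rw [Finset.sum_comm]
        exact Finset.sum_congr rfl fun x _ => Finset.sum_comm
    _ ≤ ∑ _x : Signal L, ∑ _x' : Signal L, Real.exp (-mapExponent L p) ^ N := by
        refine Finset.sum_le_sum fun x _ => Finset.sum_le_sum fun x' _ => ?_
        split_ifs with hq
        · exact hsum _ hq
        · simp only [Finset.sum_const_zero]; positivity
    _ = _ := by simp only [Finset.sum_const, Finset.card_univ, nsmul_eq_mul]; ring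

theorem errorProb_pos (hX : IsShiftTransversal X) (hP : P ∈ stdSimplex ℝ (Signal L))
    (hPX : Function.support P = X) (hp0 : 0 < p) (hp1 : p < 1) : 0 < errorProb P p d := by
  obtain ⟨q, hq⟩ := inequivPairs_nonempty (L := L)
  obtain ⟨x, hx, x', hx', hne, -, -⟩ := hX.exists_pair hq p
  have hpos : ∀ z ∈ X, 0 < P z := fun z hz =>
    lt_of_le_of_ne (hP.1 z) (Ne.symm (Function.mem_support.1 (hPX ▸ hz)))
  refine lt_of_lt_of_le ?_ (sum_min_le_errorProb hP.1 hp0 hp1 hne)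
  exact mul_pos (lt_min (hpos x hx) (hpos x' hx')) (Finset.sum_pos (fun y _ =>
    lt_min (sampleProb_pos hp0 hp1 x y) (sampleProb_pos hp0 hp1 x' y)) Finset.univ_nonempty)

theorem isMAPErrorExponent_mapExponent (hX : IsShiftTransversal X)
    (hP : P ∈ stdSimplex ℝ (Signal L)) (hPX : Function.support P = X) (hp0 : 0 < p) (hp1 : p < 1) :
    IsMAPErrorExponent P p (mapExponent L p) := by
  intro d hd
  have hpos := fun N => errorProb_pos (d := d N) hX hP hPX hp0 hp1
  refine ⟨hpos, ?_⟩
  obtain ⟨q, hq, hE⟩ := exists_mapExponent_eq L p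
  obtain ⟨x, hx, x', hx', hne, hxq, hxq'⟩ := hX.exists_pair hq p
  have hPpos : ∀ z ∈ X, 0 < P z := fun z hz =>
    lt_of_le_of_ne (hP.1 z) (Ne.symm (Function.mem_support.1 (hPX ▸ hz)))
  have hc : 0 < min (P x) (P x') := lt_min (hPpos x hx) (hPpos x' hx')
  obtain ⟨V, hV, hlow⟩ := exists_le_sum_min (obsProb_pos hp0 hp1 q.1) (obsProb_pos hp0 hp1 q.2)
    (sum_obsProb p _) (sum_obsProb p _)
  rw [← exp_neg_pairInformation hp0 hp1, ← hE] at hlow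
  set E := mapExponent L p with hEdef
  set c := min (P x) (P x') with hcdef
  obtain ⟨K, hKpos, hK⟩ : ∃ K : ℝ, 0 < K ∧ K = (Fintype.card (Signal L) : ℝ) ^ 2 :=
    ⟨_, by positivity, rfl⟩
  have hlim : Tendsto (fun N : ℕ => (N : ℝ)⁻¹) atTop (𝓝 0) := tendsto_inv_atTop_nhds_zero_nat
  have hlim' : Tendsto (fun N : ℕ => √(V * (N : ℝ)⁻¹)) atTop (𝓝 0) := by
    have := (hlim.const_mul V).sqrt
    simpa using this
  refine tendsto_of_tendsto_of_tendsto_of_le_of_le'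
    (g := fun N : ℕ => E - Real.log K * (N : ℝ)⁻¹)
    (h := fun N : ℕ => E + √(V * (N : ℝ)⁻¹) - Real.log (c * (1 / 2)) * (N : ℝ)⁻¹) ?_ ?_ ?_ ?_
  · simpa using (hlim.const_mul (Real.log K)).const_sub E
  · simpa using (hlim'.const_add E).sub (hlim.const_mul (Real.log (c * (1 / 2))))
  · filter_upwards [eventually_gt_atTop 0] with N hN
    have hN' : (0 : ℝ) < N := by exact_mod_cast hN
    have h1 := Real.log_le_log (hpos N) (errorProb_le hX hP hPX hp0 hp1 (hd N))
    rw [← hK, Real.log_mul hKpos.ne' (by positivity), Real.log_pow, Real.log_exp] at h1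
    have : -(1 / (N : ℝ) * Real.log (errorProb P p (d N))) - (E - Real.log K * (N : ℝ)⁻¹) =
        (N : ℝ)⁻¹ * (Real.log K + N * -E - Real.log (errorProb P p (d N))) := by
      field_simp; ring
    have h2 : 0 ≤ (N : ℝ)⁻¹ * (Real.log K + N * -E - Real.log (errorProb P p (d N))) :=
      mul_nonneg (by positivity) (by linarith)
    linarith
  · filter_upwards [eventually_gt_atTop 0] with N hN
    have hN' : (0 : ℝ) < N := by exact_mod_cast hN
    have h0 := sum_min_le_errorProb (d := d N) hP.1 hp0 hp1 hne
    rw [hxq, hxq'] at h0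
    have h1 := (mul_le_mul_of_nonneg_left (hlow N hN) hc.le).trans h0
    have h2 := Real.log_le_log (by positivity) h1
    have h3 : min (P x) (P x') * (Real.exp (-E) ^ N * (1 / 2 * Real.exp (-√(V * N)))) =
      c * (1 / 2) * Real.exp (N * -E + -√(V * N)) := by
      rw [Real.exp_add, Real.exp_nat_mul]; ring
    rw [h3, Real.log_mul (by positivity) (by positivity), Real.log_exp] at h2
    have h4 : √(V * (N : ℝ)⁻¹) = (N : ℝ)⁻¹ * √(V * N) := by
      rw [← Real.sqrt_sq (show 0 ≤ (N : ℝ)⁻¹ by positivity), ← Real.sqrt_mul (by positivity)]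
      congr 1
      rw [Real.sqrt_sq (by positivity)]
      field_simp
    have : (E + √(V * (N : ℝ)⁻¹) - Real.log (c * (1 / 2)) * (N : ℝ)⁻¹) -
        -(1 / (N : ℝ) * Real.log (errorProb P p (d N))) =
        (N : ℝ)⁻¹ * (Real.log (errorProb P p (d N)) -
          (Real.log (c * (1 / 2)) + (N * -E + -√(V * N)))) := by
      rw [h4]; field_simp; ring
    have h5 : 0 ≤ (N : ℝ)⁻¹ * (Real.log (errorProb P p (d N)) -
          (Real.log (c * (1 / 2)) + (N * -E + -√(V * N)))) :=
      mul_nonneg (by positivity) (by linarith)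
    linarith

end MAPExponent

/-! ### Walsh expansion of the observation law -/

section Walsh

variable {L : ℕ} [NeZero L]

/-- The sign `(-1) ^ b` of a bit. -/
noncomputable def bipolar (b : ZMod 2) : ℝ := if b = 1 then -1 else 1

theorem bipolar_add (a b : ZMod 2) : bipolar (a + b) = bipolar a * bipolar b := by
  have h : ∀ a b : ZMod 2, (a + b = 1 ↔ ¬(a = 1 ↔ b = 1)) := by decide
  unfold bipolar
  simp only [h a b]
  by_cases ha : a = 1 <;> by_cases hb : b = 1 <;> simp [ha, hb]

theorem bipolar_mul_self (a : ZMod 2) : bipolar a * bipolar a = 1 := by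
  unfold bipolar; split_ifs <;> norm_num

theorem abs_bipolar (a : ZMod 2) : |bipolar a| = 1 := by
  unfold bipolar; split_ifs <;> norm_num

/-- The Walsh function of the set `A`. -/
noncomputable def walsh (A : Finset (ZMod L)) (y : Signal L) : ℝ := ∏ j ∈ A, bipolar (y j)

omit [NeZero L] in
theorem abs_walsh (A : Finset (ZMod L)) (y : Signal L) : |walsh A y| = 1 := by
  rw [walsh, Finset.abs_prod]; exact Finset.prod_eq_one fun j _ => abs_bipolar _

omit [NeZero L] in
theorem walsh_mul_self (A : Finset (ZMod L)) (y : Signal L) : walsh A y * walsh A y = 1 := by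
  rw [walsh, ← Finset.prod_mul_distrib]; exact Finset.prod_eq_one fun j _ => bipolar_mul_self _

omit [NeZero L] in
theorem walsh_add (A : Finset (ZMod L)) (y z : Signal L) :
    walsh A (y + z) = walsh A y * walsh A z := by
  simp only [walsh, Pi.add_apply, bipolar_add, Finset.prod_mul_distrib]

omit [NeZero L] in
theorem walsh_one (A : Finset (ZMod L)) : walsh A (1 : Signal L) = (-1) ^ A.card := by
  simp [walsh, bipolar]

omit [NeZero L] in
theorem walsh_single (A : Finset (ZMod L)) (j : ZMod L) :
    walsh A (Pi.single j 1 : Signal L) = if j ∈ A then -1 else 1 := by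
  have h : ∀ i, bipolar ((Pi.single j 1 : Signal L) i) = if i = j then -1 else 1 := fun i => by
    by_cases hi : i = j
    · subst hi; simp [bipolar]
    · simp [bipolar, hi]
  simp only [walsh, h]
  rw [Finset.prod_ite_eq']

theorem sum_eq_zero_of_add_neg {F : Signal L → ℝ} (z : Signal L) (h : ∀ y, F (y + z) = -F y) :
    ∑ y, F y = 0 := by
  have h1 := Equiv.sum_comp (Equiv.addRight z) F
  simp only [Equiv.coe_addRight, h, Finset.sum_neg_distrib] at h1
  linarith

theorem card_signal : (Fintype.card (Signal L) : ℝ) = 2 ^ L := by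
  rw [Fintype.card_fun, ZMod.card, ZMod.card]; norm_num

theorem card_finset_zmod : (Fintype.card (Finset (ZMod L)) : ℝ) = 2 ^ L := by
  rw [Fintype.card_finset, ZMod.card]; norm_num

theorem sum_walsh_mul_walsh (A B : Finset (ZMod L)) :
    ∑ y, walsh A y * walsh B y = if A = B then 2 ^ L else 0 := by
  split_ifs with h
  · subst h
    simp only [walsh_mul_self, Finset.sum_const, Finset.card_univ, nsmul_eq_mul, mul_one,
      card_signal]
  · obtain ⟨j, hj⟩ : ∃ j, ¬(j ∈ A ↔ j ∈ B) := by
      by_contra hcon; push Not at hcon; exact h (Finset.ext hcon)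
    refine sum_eq_zero_of_add_neg (Pi.single j 1) fun y => ?_
    simp only [walsh_add, walsh_single]
    by_cases hA : j ∈ A <;> by_cases hB : j ∈ B <;> simp [hA, hB] at hj ⊢

/-- Complementing all bits of `y` reverses the sign of the summand. -/
theorem sum_walsh_mul_walsh_mul_walsh {A B D : Finset (ZMod L)}
    (h : Odd (A.card + B.card + D.card)) : ∑ y, walsh A y * walsh B y * walsh D y = 0 := by
  refine sum_eq_zero_of_add_neg 1 fun y => ?_
  have h1 : (-1 : ℝ) ^ A.card * (-1) ^ B.card * (-1) ^ D.card = -1 := by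
    rw [← pow_add, ← pow_add, h.neg_one_pow]
  simp only [walsh_add, walsh_one]
  linear_combination (walsh A y * walsh B y * walsh D y) * h1

/-- The function with Walsh coefficients `t ^ |A| * c A`. -/
noncomputable def walshSum (c : Finset (ZMod L) → ℝ) (t : ℝ) (y : Signal L) : ℝ :=
  ∑ A, t ^ A.card * c A * walsh A y

theorem abs_walshSum_le {c : Finset (ZMod L) → ℝ} {t B : ℝ} {k : ℕ}
    (hc : ∀ A, A.card < k → c A = 0) (hB : ∀ A, |c A| ≤ B) (ht : |t| ≤ 1) (y : Signal L) :
    |walshSum c t y| ≤ 2 ^ L * B * |t| ^ k := by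
  have hB0 : 0 ≤ B := (abs_nonneg _).trans (hB ∅)
  calc |walshSum c t y| ≤ ∑ A : Finset (ZMod L), |t ^ A.card * c A * walsh A y| :=
        Finset.abs_sum_le_sum_abs _ _
    _ ≤ ∑ _A : Finset (ZMod L), B * |t| ^ k := by
        refine Finset.sum_le_sum fun A _ => ?_
        rw [abs_mul, abs_mul, abs_walsh, mul_one, abs_pow]
        by_cases h : A.card < k
        · rw [hc A h, abs_zero, mul_zero]; positivity
        · rw [mul_comm]
          exact mul_le_mul (hB A) (pow_le_pow_of_le_one (abs_nonneg t) ht (not_lt.1 h))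
            (by positivity) hB0
    _ = _ := by
        rw [Finset.sum_const, Finset.card_univ, nsmul_eq_mul, card_finset_zmod]; ring

theorem sum_walshSum_sq (c : Finset (ZMod L) → ℝ) (t : ℝ) :
    ∑ y, walshSum c t y ^ 2 = 2 ^ L * ∑ A, (t ^ 2) ^ A.card * c A ^ 2 := by
  classical
  have h1 : ∀ y, walshSum c t y ^ 2 = ∑ A, ∑ B, t ^ A.card * c A * (t ^ B.card * c B) *
      (walsh A y * walsh B y) := fun y => by
    rw [pow_two, walshSum, Finset.sum_mul_sum]
    exact Finset.sum_congr rfl fun A _ => Finset.sum_congr rfl fun B _ => by ring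
  simp only [h1]
  rw [Finset.sum_comm, Finset.mul_sum]
  refine Finset.sum_congr rfl fun A _ => ?_
  rw [Finset.sum_comm]
  simp only [← Finset.mul_sum, sum_walsh_mul_walsh, mul_ite, mul_zero, Finset.sum_ite_eq,
    Finset.mem_univ, if_true]
  ring

theorem abs_sum_walshSum_sq_mul_le {c e : Finset (ZMod L) → ℝ} {t B : ℝ} {k : ℕ}
    (hc : ∀ A, A.card < k → c A = 0) (hB : ∀ A, |c A| ≤ B) (he : e ∅ = 0) (he1 : ∀ A, |e A| ≤ 1)
    (ht : |t| ≤ 1) :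
    |∑ y, walshSum c t y ^ 2 * walshSum e t y| ≤ 2 ^ L * (8 ^ L * B ^ 2 * (t ^ 2) ^ (k + 1)) := by
  have hB0 : 0 ≤ B := (abs_nonneg _).trans (hB ∅)
  have h1 : ∀ y, walshSum c t y ^ 2 * walshSum e t y = ∑ A, ∑ B, ∑ D,
      t ^ (A.card + B.card + D.card) * (c A * c B * e D) * (walsh A y * walsh B y * walsh D y) :=
    fun y => by
    rw [pow_two, walshSum, walshSum, Finset.sum_mul_sum, Finset.sum_mul]
    refine Finset.sum_congr rfl fun A _ => ?_
    rw [Finset.sum_mul_sum]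
    exact Finset.sum_congr rfl fun B _ => Finset.sum_congr rfl fun D _ => by ring
  have h2 : ∑ y, walshSum c t y ^ 2 * walshSum e t y = ∑ A, ∑ B, ∑ D,
      t ^ (A.card + B.card + D.card) * (c A * c B * e D) *
        ∑ y, walsh A y * walsh B y * walsh D y := by
    simp only [h1]
    rw [Finset.sum_comm]
    refine Finset.sum_congr rfl fun A _ => ?_
    rw [Finset.sum_comm]
    refine Finset.sum_congr rfl fun B _ => ?_
    rw [Finset.sum_comm]
    exact Finset.sum_congr rfl fun D _ => by rw [Finset.mul_sum]
  have h3 : ∀ A E D : Finset (ZMod L), |t ^ (A.card + E.card + D.card) * (c A * c E * e D) *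
      ∑ y, walsh A y * walsh E y * walsh D y| ≤ 2 ^ L * (B ^ 2 * (t ^ 2) ^ (k + 1)) :=
    fun A E D => by
    have hnn : 0 ≤ 2 ^ L * (B ^ 2 * (t ^ 2) ^ (k + 1)) := by positivity
    by_cases hA : A.card < k
    · simpa [hc A hA] using hnn
    by_cases hE : E.card < k
    · simpa [hc E hE] using hnn
    by_cases hD : D = ∅
    · simpa [hD, he] using hnn
    by_cases hodd : Odd (A.card + E.card + D.card)
    · rw [sum_walsh_mul_walsh_mul_walsh hodd, mul_zero, abs_zero]; exact hnn
    have hD' : 0 < D.card := Finset.card_pos.2 (Finset.nonempty_iff_ne_empty.2 hD)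
    -- The sizes give at least 2k + 1, and evenness raises this to 2k + 2: a full extra power of t².
    have hcard : 2 * (k + 1) ≤ A.card + E.card + D.card := by
      rw [Nat.not_odd_iff_even, Nat.even_iff] at hodd; omega
    have hw : |∑ y, walsh A y * walsh E y * walsh D y| ≤ 2 ^ L := by
      refine (Finset.abs_sum_le_sum_abs _ _).trans ?_
      simp [abs_mul, abs_walsh]
    have hco : |c A * c E * e D| ≤ B ^ 2 := by
      rw [abs_mul, abs_mul]
      calc |c A| * |c E| * |e D| ≤ B * B * 1 := by
            gcongr; exacts [hB A, hB E, he1 D]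
        _ = B ^ 2 := by ring
    have htp : |t ^ (A.card + E.card + D.card)| ≤ (t ^ 2) ^ (k + 1) := by
      rw [abs_pow, ← sq_abs, ← pow_mul]
      exact pow_le_pow_of_le_one (abs_nonneg t) ht hcard
    rw [abs_mul, abs_mul]
    calc _ ≤ (t ^ 2) ^ (k + 1) * B ^ 2 * 2 ^ L := by gcongr
      _ = _ := by ring
  rw [h2]
  calc _ ≤ ∑ A : Finset (ZMod L), ∑ E : Finset (ZMod L), ∑ D : Finset (ZMod L),
        2 ^ L * (B ^ 2 * (t ^ 2) ^ (k + 1)) := by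
        refine (Finset.abs_sum_le_sum_abs _ _).trans (Finset.sum_le_sum fun A _ => ?_)
        refine (Finset.abs_sum_le_sum_abs _ _).trans (Finset.sum_le_sum fun E _ => ?_)
        exact (Finset.abs_sum_le_sum_abs _ _).trans (Finset.sum_le_sum fun D _ => h3 A E D)
    _ = _ := by
        simp only [Finset.sum_const, Finset.card_univ, nsmul_eq_mul, card_finset_zmod]
        rw [show (8 : ℝ) = 2 * 2 * 2 by norm_num, mul_pow, mul_pow]; ring

/-- The autocorrelation of order `|A|` of the signal `x` at the positions `A`. -/
noncomputable def moment (A : Finset (ZMod L)) (x : Signal L) : ℝ :=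
  1 / (L : ℝ) * ∑ s : ZMod L, walsh A (cyclicShift s x)

theorem moment_empty (x : Signal L) : moment ∅ x = 1 := by
  have : (L : ℝ) ≠ 0 := by exact_mod_cast NeZero.ne L
  simp [moment, walsh, ZMod.card, this]

theorem abs_moment_le (A : Finset (ZMod L)) (x : Signal L) : |moment A x| ≤ 1 := by
  have hL : (0 : ℝ) < L := by exact_mod_cast NeZero.pos L
  rw [moment, abs_mul, abs_of_pos (show 0 < 1 / (L : ℝ) by positivity), one_div,
    inv_mul_le_iff₀ hL, mul_one]
  refine (Finset.abs_sum_le_sum_abs _ _).trans ?_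
  simp [abs_walsh, ZMod.card]

/-- Each Bernoulli weight is an affine function of the sign of its bit; multiplying out the product
over positions gives the sum over subsets. -/
theorem noiseProb_eq_walshSum (p : ℝ) (z : Signal L) :
    noiseProb p z = (1 / 2) ^ L * ∑ A : Finset (ZMod L), (1 - 2 * p) ^ A.card * walsh A z := by
  have h1 : ∀ b : ZMod 2, (if b = 1 then p else 1 - p) = 1 / 2 * (1 + (1 - 2 * p) * bipolar b) :=
    fun b => by unfold bipolar; split_ifs <;> ring
  simp only [noiseProb, h1]
  rw [Finset.prod_mul_distrib, Finset.prod_const, Finset.card_univ, ZMod.card,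
    Finset.prod_one_add, Finset.powerset_univ]
  simp only [Finset.prod_mul_distrib, Finset.prod_const, walsh]

theorem obsProb_eq_walshSum (p : ℝ) (x y : Signal L) :
    obsProb p x y = (1 / 2) ^ L * walshSum (fun A => moment A x) (1 - 2 * p) y := by
  rw [obsProb_eq]
  simp only [noiseProb_eq_walshSum]
  rw [← Finset.mul_sum, Finset.sum_comm, walshSum, mul_left_comm, Finset.mul_sum]
  congr 1
  refine Finset.sum_congr rfl fun A _ => ?_
  rw [← Finset.mul_sum, moment]
  have : ∀ s, walsh A (y - cyclicShift s x) = walsh A (cyclicShift s x) * walsh A y := fun s => by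
    have h2 : y - cyclicShift s x = cyclicShift s x + y := by
      rw [sub_eq_add_neg, add_comm]
      congr 1
      funext j
      simp [ZMod.neg_eq_self_mod_two]
    rw [h2, walsh_add]
  simp only [this, ← Finset.sum_mul]
  ring

end Walsh

/-! ### Second-order bounds for the geometric mean -/

/-- The root is at most m - h² / (8m), and 1 / m ≥ 2 - m. The term linear in m - 1 is kept because
its sum over observations is controlled by parity, not by size. -/
theorem sqrt_mul_le {m h : ℝ} (ha : 0 < m + h / 2) (hb : 0 < m - h / 2) :
    √((m + h / 2) * (m - h / 2)) ≤ m - h ^ 2 / 8 + h ^ 2 * (m - 1) / 8 := by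
  have hm : 0 < m := by linarith
  have h1 : √((m + h / 2) * (m - h / 2)) ≤ m - h ^ 2 / (8 * m) := by
    rw [Real.sqrt_le_left]
    · have : (m - h ^ 2 / (8 * m)) ^ 2 = m ^ 2 - h ^ 2 / 4 + (h ^ 2 / (8 * m)) ^ 2 := by
        field_simp; ring
      rw [this]; nlinarith [sq_nonneg (h ^ 2 / (8 * m))]
    · rw [sub_nonneg, div_le_iff₀ (by positivity)]; nlinarith
  have h2 : h ^ 2 * (2 - m) / 8 ≤ h ^ 2 / (8 * m) := by
    rw [div_le_div_iff₀ (by norm_num) (by positivity)]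
    nlinarith [mul_nonneg (sq_nonneg h) (sq_nonneg (m - 1))]
  linarith

/-- With w = h² / (4m²) this uses √(1 - w) ≥ 1 - w/2 - w²/2 on [0, 1] and 1 / m ≤ 1 - (m - 1) + 2(m
- 1)², valid for m ≥ 1/2. -/
theorem le_sqrt_mul {m h : ℝ} (hm : 1 / 2 ≤ m) (ha : 0 < m + h / 2) (hb : 0 < m - h / 2) :
    m - h ^ 2 / 8 + h ^ 2 * (m - 1) / 8 - h ^ 2 * (m - 1) ^ 2 / 4 - h ^ 4 / 4 ≤
      √((m + h / 2) * (m - h / 2)) := by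
  have hm0 : 0 < m := by linarith
  have hw : h ^ 2 / (4 * m ^ 2) ≤ 1 := by
    rw [div_le_one (by positivity)]; nlinarith
  set w := h ^ 2 / (4 * m ^ 2) with hwdef
  have hw0 : 0 ≤ w := by positivity
  have h1 : m * (1 - w / 2 - w ^ 2 / 2) ≤ √((m + h / 2) * (m - h / 2)) := by
    have h2 : (m + h / 2) * (m - h / 2) = m ^ 2 * (1 - w) := by
      rw [hwdef]; field_simp; ring
    rw [h2, Real.sqrt_mul (by positivity), Real.sqrt_sq hm0.le]
    refine mul_le_mul_of_nonneg_left (Real.le_sqrt_of_sq_le ?_) hm0.le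
    nlinarith [mul_nonneg (sq_nonneg w) (sub_nonneg.2 hw), mul_nonneg hw0 (sub_nonneg.2 hw),
      mul_nonneg (mul_nonneg (sq_nonneg w) hw0) (sub_nonneg.2 hw)]
  refine le_trans ?_ h1
  have h3 : m * w ≤ h ^ 2 / 4 * (1 - (m - 1) + 2 * (m - 1) ^ 2) := by
    rw [hwdef, mul_div_assoc', div_le_iff₀ (by positivity)]
    have : 1 ≤ m * (1 - (m - 1) + 2 * (m - 1) ^ 2) := by
      nlinarith [mul_nonneg (sq_nonneg (m - 1)) (show 0 ≤ 2 * m - 1 by linarith)]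
    have h4 := mul_le_mul_of_nonneg_left this (show 0 ≤ m * h ^ 2 by positivity)
    nlinarith
  have h5 : m * w ^ 2 ≤ h ^ 4 / 2 := by
    have h6 : m * w ^ 2 = h ^ 4 / (16 * m ^ 3) := by rw [hwdef]; field_simp; ring
    rw [h6, div_le_div_iff₀ (by positivity) (by norm_num)]
    have : 2 ≤ 16 * m ^ 3 := by
      have := pow_le_pow_left₀ (by norm_num) hm 3
      nlinarith
    nlinarith [mul_le_mul_of_nonneg_left this (show 0 ≤ h ^ 4 by positivity)]
  nlinarith

/-! ### Low-SNR expansion of the Bhattacharyya distance -/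

section Expansion

variable {L : ℕ} [NeZero L]

/-- The squared distance between the autocorrelations of order `k` of two signals. -/
noncomputable def momentGap (k : ℕ) (q : Signal L × Signal L) : ℝ :=
  ∑ A ∈ Finset.powersetCard k Finset.univ, (moment A q.1 - moment A q.2) ^ 2

/-- The difference of the autocorrelations of two signals. -/
noncomputable def momentDiff (q : Signal L × Signal L) (A : Finset (ZMod L)) : ℝ :=
  moment A q.1 - moment A q.2

/-- The mean of the autocorrelations of positive order of two signals. -/
noncomputable def momentMean (q : Signal L × Signal L) (A : Finset (ZMod L)) : ℝ :=
  if A = ∅ then 0 else (moment A q.1 + moment A q.2) / 2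

theorem abs_momentDiff_le (q : Signal L × Signal L) (A : Finset (ZMod L)) :
    |momentDiff q A| ≤ 2 := by
  have h1 := abs_le.1 (abs_moment_le A q.1)
  have h2 := abs_le.1 (abs_moment_le A q.2)
  exact abs_le.2 ⟨by unfold momentDiff; linarith, by unfold momentDiff; linarith⟩

theorem abs_momentMean_le (q : Signal L × Signal L) (A : Finset (ZMod L)) :
    |momentMean q A| ≤ 1 := by
  have h1 := abs_le.1 (abs_moment_le A q.1)
  have h2 := abs_le.1 (abs_moment_le A q.2)
  unfold momentMean
  split_ifs
  · simp
  · exact abs_le.2 ⟨by linarith, by linarith⟩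

theorem momentMean_empty (q : Signal L × Signal L) : momentMean q ∅ = 0 := if_pos rfl

theorem half_add_moment (q : Signal L × Signal L) (t : ℝ) (y : Signal L) :
    walshSum (fun A => moment A q.1) t y / 2 + walshSum (fun A => moment A q.2) t y / 2 =
      1 + walshSum (momentMean q) t y := by
  classical
  have h : ∀ A : Finset (ZMod L), t ^ A.card * moment A q.1 * walsh A y / 2 +
      t ^ A.card * moment A q.2 * walsh A y / 2 =
      (if A = ∅ then 1 else 0) + t ^ A.card * momentMean q A * walsh A y := fun A => by
    unfold momentMean
    split_ifs with hA
    · subst hA; simp [moment_empty, walsh]; norm_num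
    · ring
  simp only [walshSum, Finset.sum_div, ← Finset.sum_add_distrib, h]
  simp [Finset.sum_add_distrib]

theorem walshSum_momentDiff (q : Signal L × Signal L) (t : ℝ) (y : Signal L) :
    walshSum (momentDiff q) t y =
      walshSum (fun A => moment A q.1) t y - walshSum (fun A => moment A q.2) t y := by
  simp only [walshSum, ← Finset.sum_sub_distrib, momentDiff]
  exact Finset.sum_congr rfl fun A _ => by ring

variable {p : ℝ} {q : Signal L × Signal L} {k : ℕ}

/-- Relative to the uniform law the two densities are m ± h/2, with m - 1 and h the Walsh sums of
`momentMean` and `momentDiff`. -/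
theorem affinity_half_eq (hp0 : 0 < p) (hp1 : p < 1) (q : Signal L × Signal L) :
    affinity (obsProb p q.1) (obsProb p q.2) (1 / 2) = (1 / 2) ^ L * ∑ y,
      √((1 + walshSum (momentMean q) (1 - 2 * p) y + walshSum (momentDiff q) (1 - 2 * p) y / 2) *
        (1 + walshSum (momentMean q) (1 - 2 * p) y -
          walshSum (momentDiff q) (1 - 2 * p) y / 2)) := by
  rw [affinity, Finset.mul_sum]
  refine Finset.sum_congr rfl fun y _ => ?_
  have h1 := obsProb_pos hp0 hp1 q.1 y
  have h2 := obsProb_pos hp0 hp1 q.2 y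
  rw [show (1 : ℝ) - 1 / 2 = 1 / 2 by norm_num, ← Real.mul_rpow h1.le h2.le, ← Real.sqrt_eq_rpow,
    ← half_add_moment, walshSum_momentDiff, obsProb_eq_walshSum, obsProb_eq_walshSum]
  rw [← Real.sqrt_sq (show (0 : ℝ) ≤ (1 / 2) ^ L by positivity),
    ← Real.sqrt_mul (by positivity)]
  congr 1
  rw [Real.sqrt_sq (by positivity)]
  ring

theorem walshSum_moment_pos (hp0 : 0 < p) (hp1 : p < 1) (x y : Signal L) :
    0 < walshSum (fun A => moment A x) (1 - 2 * p) y := by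
  have h := obsProb_pos hp0 hp1 x y
  rw [obsProb_eq_walshSum] at h
  exact (mul_pos_iff_of_pos_left (by positivity)).1 h

theorem mean_add_diff_pos (hp0 : 0 < p) (hp1 : p < 1) (q : Signal L × Signal L) (y : Signal L) :
    0 < 1 + walshSum (momentMean q) (1 - 2 * p) y + walshSum (momentDiff q) (1 - 2 * p) y / 2 := by
  rw [← half_add_moment, walshSum_momentDiff]
  linarith [walshSum_moment_pos hp0 hp1 q.1 y]

theorem mean_sub_diff_pos (hp0 : 0 < p) (hp1 : p < 1) (q : Signal L × Signal L) (y : Signal L) :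
    0 < 1 + walshSum (momentMean q) (1 - 2 * p) y - walshSum (momentDiff q) (1 - 2 * p) y / 2 := by
  rw [← half_add_moment, walshSum_momentDiff]
  linarith [walshSum_moment_pos hp0 hp1 q.2 y]

theorem sum_walshSum_momentMean (q : Signal L × Signal L) (t : ℝ) :
    ∑ y, walshSum (momentMean q) t y = 0 := by
  classical
  simp only [walshSum]
  rw [Finset.sum_comm]
  refine Finset.sum_eq_zero fun A _ => ?_
  rw [← Finset.mul_sum]
  by_cases hA : A = ∅
  · rw [hA, momentMean_empty, mul_zero, zero_mul]
  · have := sum_walsh_mul_walsh A ∅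
    rw [if_neg hA] at this
    simp only [show ∀ y : Signal L, walsh ∅ y = 1 from fun y => by simp [walsh], mul_one] at this
    rw [this, mul_zero]

theorem four_mul_snr (p : ℝ) : 4 * snr p = (1 - 2 * p) ^ 2 := by unfold snr; ring

theorem snr_nonneg (p : ℝ) : 0 ≤ snr p := sq_nonneg _

theorem abs_one_sub_two_mul_le (hp0 : 0 < p) (hp1 : p < 1) : |1 - 2 * p| ≤ 1 :=
  abs_le.2 ⟨by linarith, by linarith⟩

theorem half_pow_mul_two_pow (L : ℕ) : ((1 : ℝ) / 2) ^ L * 2 ^ L = 1 := by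
  rw [← mul_pow]; norm_num

/-- Summing `sqrt_mul_le` over observations, m - 1 averages to zero, h² is evaluated by Parseval,
and the mixed term h² * (m - 1) is small by parity. -/
theorem affinity_half_le (hp0 : 0 < p) (hp1 : p < 1)
    (hq : ∀ A : Finset (ZMod L), A.card < k → moment A q.1 = moment A q.2) :
    affinity (obsProb p q.1) (obsProb p q.2) (1 / 2) ≤
      1 - (4 * snr p) ^ k * momentGap k q / 8 + 8 ^ L * (4 * snr p) ^ (k + 1) := by
  have hc : ∀ A, A.card < k → momentDiff q A = 0 := fun A hA => sub_eq_zero.2 (hq A hA)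
  rw [affinity_half_eq hp0 hp1, four_mul_snr]
  set t := 1 - 2 * p with ht
  have h1 : ∑ y, √((1 + walshSum (momentMean q) t y + walshSum (momentDiff q) t y / 2) *
        (1 + walshSum (momentMean q) t y - walshSum (momentDiff q) t y / 2)) ≤
      ∑ y, (1 + walshSum (momentMean q) t y - walshSum (momentDiff q) t y ^ 2 / 8 +
        walshSum (momentDiff q) t y ^ 2 * walshSum (momentMean q) t y / 8) :=
    Finset.sum_le_sum fun y _ => by
      simpa using sqrt_mul_le (mean_add_diff_pos hp0 hp1 q y) (mean_sub_diff_pos hp0 hp1 q y)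
  have h2 := (abs_le.1 (abs_sum_walshSum_sq_mul_le hc (abs_momentDiff_le q) (momentMean_empty q)
    (abs_momentMean_le q) (abs_one_sub_two_mul_le hp0 hp1))).2
  have h3 : (t ^ 2) ^ k * momentGap k q ≤ ∑ A, (t ^ 2) ^ A.card * momentDiff q A ^ 2 := by
    rw [momentGap, Finset.mul_sum]
    calc _ = ∑ A ∈ Finset.powersetCard k Finset.univ, (t ^ 2) ^ A.card * momentDiff q A ^ 2 :=
          Finset.sum_congr rfl fun A hA => by rw [(Finset.mem_powersetCard.1 hA).2, momentDiff]
      _ ≤ _ := Finset.sum_le_sum_of_subset_of_nonneg (Finset.subset_univ _)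
          fun A _ _ => by positivity
  rw [Finset.sum_add_distrib, Finset.sum_sub_distrib, Finset.sum_add_distrib,
    sum_walshSum_momentMean, ← Finset.sum_div, ← Finset.sum_div, sum_walshSum_sq] at h1
  simp only [Finset.sum_const, Finset.card_univ, nsmul_eq_mul, card_signal, mul_one] at h1
  have h4 := half_pow_mul_two_pow L
  calc _ ≤ (1 / 2) ^ L * _ := mul_le_mul_of_nonneg_left h1 (by positivity)
    _ ≤ (1 / 2) ^ L * (2 ^ L + 0 - 2 ^ L * ((t ^ 2) ^ k * momentGap k q) / 8 +
        2 ^ L * (8 ^ L * 2 ^ 2 * (t ^ 2) ^ (k + 1)) / 8) := by gcongr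
    _ = ((1 / 2) ^ L * 2 ^ L) * (1 - (t ^ 2) ^ k * momentGap k q / 8 +
        8 ^ L * (t ^ 2) ^ (k + 1) / 2) := by ring
    _ ≤ _ := by
      rw [h4, one_mul]
      have : 0 ≤ 8 ^ L * (t ^ 2) ^ (k + 1) := by positivity
      linarith

theorem le_pairInformation (hp0 : 0 < p) (hp1 : p < 1)
    (hq : ∀ A : Finset (ZMod L), A.card < k → moment A q.1 = moment A q.2) :
    (4 * snr p) ^ k * momentGap k q / 8 - 8 ^ L * (4 * snr p) ^ (k + 1) ≤ pairInformation p q := by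
  have hP := obsProb_pos hp0 hp1 q.1
  have hQ := obsProb_pos hp0 hp1 q.2
  have h1 := affinity_half_le hp0 hp1 hq
  have h2 := chernoffCoeff_le hP hQ (t := 1 / 2) (by norm_num)
  have h3 := Real.log_le_sub_one_of_pos (chernoffCoeff_pos hP hQ (sum_obsProb p _)
    (sum_obsProb p _))
  unfold pairInformation
  linarith

/-- The smallness hypothesis ensures m ≥ 1/2. The new remainders h² * (m - 1)² and h⁴ are of order
t^(2k+2) and t^(4k); since k ≥ 1 both fit the error term. -/
theorem le_affinity_half (hp0 : 0 < p) (hp1 : p < 1) (hk : 1 ≤ k)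
    (hq : ∀ A : Finset (ZMod L), A.card < k → moment A q.1 = moment A q.2)
    (hsmall : 2 ^ L * |1 - 2 * p| ≤ 1 / 2) :
    1 - (4 * snr p) ^ k * momentGap k q / 8 - 5 * 16 ^ L * 4 * (4 * snr p) ^ (k + 1) ≤
      affinity (obsProb p q.1) (obsProb p q.2) (1 / 2) := by
  have hc : ∀ A, A.card < k → momentDiff q A = 0 := fun A hA => sub_eq_zero.2 (hq A hA)
  have hcm : ∀ A, A.card < 1 → momentMean q A = 0 := fun A hA => by
    rw [Finset.card_eq_zero.1 (Nat.lt_one_iff.1 hA), momentMean_empty]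
  have habs := abs_one_sub_two_mul_le hp0 hp1
  rw [affinity_half_eq hp0 hp1, four_mul_snr]
  set t := 1 - 2 * p with ht
  have hf : ∀ y, |walshSum (momentMean q) t y| ≤ 2 ^ L * |t| := fun y => by
    simpa using abs_walshSum_le hcm (abs_momentMean_le q) habs y
  have hh : ∀ y, |walshSum (momentDiff q) t y| ≤ 2 ^ L * 2 * |t| ^ k := fun y =>
    abs_walshSum_le hc (abs_momentDiff_le q) habs y
  set T := (t ^ 2) ^ (k + 1) with hT
  have hTnn : 0 ≤ T := by positivity
  have hh2 : ∀ y, walshSum (momentDiff q) t y ^ 2 ≤ 4 ^ L * 4 * (t ^ 2) ^ k := fun y => by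
    rw [← sq_abs]
    calc _ ≤ (2 ^ L * 2 * |t| ^ k) ^ 2 := by gcongr; exact hh y
      _ = _ := by
        rw [mul_pow, mul_pow, pow_right_comm, pow_right_comm |t|, sq_abs]; norm_num
  have hf2 : ∀ y, walshSum (momentMean q) t y ^ 2 ≤ 4 ^ L * t ^ 2 := fun y => by
    rw [← sq_abs]
    calc _ ≤ (2 ^ L * |t|) ^ 2 := by gcongr; exact hf y
      _ = _ := by rw [mul_pow, ← pow_mul, mul_comm L 2, pow_mul, sq_abs]; norm_num
  have h16 : (4 : ℝ) ^ L * 4 ^ L = 16 ^ L := by rw [← mul_pow]; norm_num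
  have hhf : ∀ y, walshSum (momentDiff q) t y ^ 2 * walshSum (momentMean q) t y ^ 2 ≤
      16 ^ L * 4 * T := fun y => by
    calc _ ≤ (4 ^ L * 4 * (t ^ 2) ^ k) * (4 ^ L * t ^ 2) :=
          mul_le_mul (hh2 y) (hf2 y) (sq_nonneg _) (by positivity)
      _ = _ := by rw [hT, pow_succ, ← h16]; ring
  have hh4 : ∀ y, walshSum (momentDiff q) t y ^ 4 ≤ 16 ^ L * 16 * T := fun y => by
    calc _ = walshSum (momentDiff q) t y ^ 2 * walshSum (momentDiff q) t y ^ 2 := by ring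
      _ ≤ (4 ^ L * 4 * (t ^ 2) ^ k) * (4 ^ L * 4 * (t ^ 2) ^ k) :=
          mul_le_mul (hh2 y) (hh2 y) (sq_nonneg _) (by positivity)
      _ = 16 ^ L * 16 * (t ^ 2) ^ (k + k) := by rw [pow_add, ← h16]; ring
      _ ≤ _ := by
          rw [hT]
          gcongr 16 ^ L * 16 * ?_
          exact pow_le_pow_of_le_one (sq_nonneg t) ((sq_le_one_iff_abs_le_one t).2 habs)
            (by omega)
  have h1 : ∑ y, (1 + walshSum (momentMean q) t y - walshSum (momentDiff q) t y ^ 2 / 8 +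
        walshSum (momentDiff q) t y ^ 2 * walshSum (momentMean q) t y / 8 -
        (16 ^ L * 4 * T / 4 + 16 ^ L * 16 * T / 4)) ≤
      ∑ y, √((1 + walshSum (momentMean q) t y + walshSum (momentDiff q) t y / 2) *
        (1 + walshSum (momentMean q) t y - walshSum (momentDiff q) t y / 2)) :=
    Finset.sum_le_sum fun y _ => by
      have hm : 1 / 2 ≤ 1 + walshSum (momentMean q) t y := by
        linarith [(abs_le.1 ((hf y).trans hsmall)).1]
      have := le_sqrt_mul hm (mean_add_diff_pos hp0 hp1 q y) (mean_sub_diff_pos hp0 hp1 q y)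
      rw [add_sub_cancel_left] at this
      linarith [hhf y, hh4 y]
  have h2 := (abs_le.1 (abs_sum_walshSum_sq_mul_le hc (abs_momentDiff_le q) (momentMean_empty q)
    (abs_momentMean_le q) habs)).1
  have h3 : ∑ A, (t ^ 2) ^ A.card * momentDiff q A ^ 2 ≤
      (t ^ 2) ^ k * momentGap k q + 2 ^ L * (4 * T) := by
    classical
    have hpt : ∀ A : Finset (ZMod L), (t ^ 2) ^ A.card * momentDiff q A ^ 2 ≤
        (if A ∈ Finset.powersetCard k Finset.univ then (t ^ 2) ^ k * momentDiff q A ^ 2 else 0) +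
          4 * T := fun A => by
      have hsq : momentDiff q A ^ 2 ≤ 4 := by
        rw [← sq_abs]
        calc _ ≤ (2 : ℝ) ^ 2 := by gcongr; exact abs_momentDiff_le q A
          _ = 4 := by norm_num
      split_ifs with hA
      · rw [(Finset.mem_powersetCard.1 hA).2]; linarith
      · rcases lt_or_ge A.card k with h | h
        · rw [hc A h]; simp; positivity
        · have hne : A.card ≠ k := fun h' =>
            hA (Finset.mem_powersetCard.2 ⟨Finset.subset_univ _, h'⟩)
          rw [zero_add, mul_comm]
          refine mul_le_mul hsq ?_ (by positivity) (by norm_num)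
          exact pow_le_pow_of_le_one (sq_nonneg t) ((sq_le_one_iff_abs_le_one t).2 habs)
            (by omega)
    refine (Finset.sum_le_sum fun A _ => hpt A).trans (le_of_eq ?_)
    rw [Finset.sum_add_distrib, Finset.sum_ite_mem, Finset.univ_inter, ← Finset.mul_sum,
      Finset.sum_const, Finset.card_univ, nsmul_eq_mul, card_finset_zmod]
    rfl
  rw [Finset.sum_sub_distrib, Finset.sum_add_distrib, Finset.sum_sub_distrib,
    Finset.sum_add_distrib,
    sum_walshSum_momentMean, ← Finset.sum_div, ← Finset.sum_div, sum_walshSum_sq] at h1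
  simp only [Finset.sum_const, Finset.card_univ, nsmul_eq_mul, card_signal, mul_one] at h1
  have h4 := half_pow_mul_two_pow L
  have hpows : (2 : ℝ) ^ L ≤ 16 ^ L := by gcongr; norm_num
  have hpows' : (8 : ℝ) ^ L ≤ 16 ^ L := by gcongr; norm_num
  refine le_trans ?_ (mul_le_mul_of_nonneg_left h1 (by positivity : (0 : ℝ) ≤ (1 / 2) ^ L))
  -- The three losses are Parseval terms of order above k, the parity term, and the pointwise
  -- remainders; together at most 6 * 16^L * T, within the stated 20 * 16^L * T.
  calc _ ≤ 1 - (t ^ 2) ^ k * momentGap k q / 8 - 2 ^ L * T / 2 - 8 ^ L * T / 2 -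
        16 ^ L * 5 * T := by
        nlinarith [mul_le_mul_of_nonneg_right hpows hTnn, mul_le_mul_of_nonneg_right hpows' hTnn,
          mul_nonneg (show (0 : ℝ) ≤ 16 ^ L by positivity) hTnn]
    _ = ((1 / 2) ^ L * 2 ^ L) * (1 - (t ^ 2) ^ k * momentGap k q / 8 - 2 ^ L * T / 2 -
        8 ^ L * T / 2 - 16 ^ L * 5 * T) := by rw [h4, one_mul]
    _ = (1 / 2) ^ L * (2 ^ L + 0 - 2 ^ L * ((t ^ 2) ^ k * momentGap k q + 2 ^ L * (4 * T)) / 8 +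
        -(2 ^ L * (8 ^ L * 2 ^ 2 * T)) / 8 -
        2 ^ L * (16 ^ L * 4 * T / 4 + 16 ^ L * 16 * T / 4)) := by ring
    _ ≤ _ := by gcongr

omit [NeZero L] in
theorem eventually_near_half : ∀ᶠ p : ℝ in 𝓝 (1 / 2),
    0 < p ∧ p < 1 ∧ 2 ^ L * |1 - 2 * p| ≤ 1 / 2 ∧ snr p ≤ 1 := by
  have h1 : Tendsto (fun p : ℝ => 2 ^ L * |1 - 2 * p|) (𝓝 (1 / 2)) (𝓝 0) := by
    have : Continuous fun p : ℝ => 2 ^ L * |1 - 2 * p| := by fun_prop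
    simpa using this.tendsto (1 / 2)
  have h2 : Tendsto snr (𝓝 (1 / 2)) (𝓝 0) := by
    have : Continuous snr := by unfold snr; fun_prop
    simpa [snr] using this.tendsto (1 / 2)
  filter_upwards [Ioo_mem_nhds (show (0 : ℝ) < 1 / 2 by norm_num)
    (show (1 / 2 : ℝ) < 1 by norm_num), h1.eventually (ge_mem_nhds (show (0 : ℝ) < 1 / 2 by
    norm_num)), h2.eventually (ge_mem_nhds one_pos)] with p hp h3 h4
  exact ⟨hp.1, hp.2, h3, h4⟩

/-- For an affinity r ≥ 1/2, -log r ≤ (1 - r) + 2(1 - r)², and the square is of order SNR^(2k),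
absorbed because k ≥ 1. -/
theorem exists_neg_log_affinity_half_le (hk : 1 ≤ k)
    (hq : ∀ A : Finset (ZMod L), A.card < k → moment A q.1 = moment A q.2) :
    ∃ K : ℝ, ∀ᶠ p in 𝓝 (1 / 2), -Real.log (affinity (obsProb p q.1) (obsProb p q.2) (1 / 2)) ≤
      (4 * snr p) ^ k * momentGap k q / 8 + K * snr p ^ (k + 1) := by
  set G := momentGap k q / 8 with hG
  have hG0 : 0 ≤ G := div_nonneg (Finset.sum_nonneg fun A _ => sq_nonneg _) (by norm_num)
  set M : ℝ := 5 * 16 ^ L * 4 * 4 ^ (k + 1) with hM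
  have hM0 : 0 ≤ M := by positivity
  set B : ℝ := 4 ^ k * G + M with hB
  have hB0 : 0 ≤ B := by positivity
  refine ⟨M + 2 * B ^ 2, ?_⟩
  have hlim : Tendsto (fun p => B * snr p) (𝓝 (1 / 2)) (𝓝 0) := by
    have : Continuous fun p => B * snr p := by unfold snr; fun_prop
    simpa [snr] using this.tendsto (1 / 2)
  filter_upwards [eventually_near_half (L := L), hlim.eventually (ge_mem_nhds
    (show (0 : ℝ) < 1 / 2 by norm_num))] with p ⟨hp0, hp1, hsmall, hsnr1⟩ hBs
  have h1 := le_affinity_half hp0 hp1 hk hq hsmall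
  set r := affinity (obsProb p q.1) (obsProb p q.2) (1 / 2) with hr
  have hs0 := snr_nonneg p
  set s := snr p with hs
  have hrpos : 0 < r := affinity_pos (obsProb_pos hp0 hp1 _) (obsProb_pos hp0 hp1 _) _
  have hr1 : r ≤ 1 := affinity_le_one (obsProb_pos hp0 hp1 _) (obsProb_pos hp0 hp1 _)
    (sum_obsProb p _) (sum_obsProb p _) (by norm_num)
  have h2 : 1 - r ≤ 4 ^ k * G * s ^ k + M * s ^ (k + 1) := by
    have : (4 * s) ^ k * momentGap k q / 8 + 5 * 16 ^ L * 4 * (4 * s) ^ (k + 1) =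
      4 ^ k * G * s ^ k + M * s ^ (k + 1) := by rw [hG, hM, mul_pow, mul_pow]; ring
    linarith
  have h3 : 1 - r ≤ B * s ^ k := by
    have : M * s ^ (k + 1) ≤ M * s ^ k :=
      mul_le_mul_of_nonneg_left (pow_le_pow_of_le_one hs0 hsnr1 (Nat.le_succ k)) hM0
    rw [hB, add_mul]; linarith
  have h4 : 1 - r ≤ 1 / 2 := by
    refine h3.trans (le_trans (mul_le_mul_of_nonneg_left ?_ hB0) hBs)
    simpa using pow_le_pow_of_le_one hs0 hsnr1 hk
  have h5 : (1 - r) ^ 2 ≤ B ^ 2 * s ^ (k + 1) := by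
    calc (1 - r) ^ 2 ≤ (B * s ^ k) ^ 2 := pow_le_pow_left₀ (by linarith) h3 2
      _ = B ^ 2 * s ^ (k * 2) := by rw [mul_pow, ← pow_mul]
      _ ≤ _ := mul_le_mul_of_nonneg_left (pow_le_pow_of_le_one hs0 hsnr1 (by omega))
        (sq_nonneg B)
  have h6 : -Real.log r ≤ r⁻¹ - 1 := by
    rw [← Real.log_inv]; exact Real.log_le_sub_one_of_pos (inv_pos.2 hrpos)
  have h7 : r⁻¹ ≤ 1 + (1 - r) + 2 * (1 - r) ^ 2 := by
    rw [inv_le_iff_one_le_mul₀ hrpos]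
    nlinarith [mul_nonneg (sq_nonneg (1 - r)) (show 0 ≤ 1 - 2 * (1 - r) by linarith)]
  have : (4 * s) ^ k * momentGap k q / 8 = 4 ^ k * G * s ^ k := by rw [hG, mul_pow]; ring
  rw [this]
  linarith

theorem pairInformation_nonneg (hp0 : 0 < p) (hp1 : p < 1) (q : Signal L × Signal L) :
    0 ≤ pairInformation p q := by
  have hP := obsProb_pos hp0 hp1 q.1
  have hQ := obsProb_pos hp0 hp1 q.2
  rw [pairInformation, neg_nonneg]
  refine Real.log_nonpos (chernoffCoeff_pos hP hQ (sum_obsProb p _) (sum_obsProb p _)).le ?_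
  exact (chernoffCoeff_le hP hQ (t := 0) (by norm_num)).trans_eq (affinity_zero (sum_obsProb p _))

theorem pairInformation_le_two_mul (hp0 : 0 < p) (hp1 : p < 1) (q : Signal L × Signal L) :
    pairInformation p q ≤
      2 * -Real.log (affinity (obsProb p q.1) (obsProb p q.2) (1 / 2)) := by
  have hP := obsProb_pos hp0 hp1 q.1
  have hQ := obsProb_pos hp0 hp1 q.2
  have h := Real.log_le_log (pow_pos (affinity_pos hP hQ _) 2)
    (affinity_half_sq_le_chernoffCoeff hP hQ (sum_obsProb p _) (sum_obsProb p _))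
  rw [Real.log_pow] at h
  push_cast at h
  unfold pairInformation
  linarith

end Expansion

/-! ### Integrality of moment differences -/

section PatternCount

variable {L : ℕ} [NeZero L]

/-- A bit as an integer. -/
def bitValue (b : ZMod 2) : ℤ := if b = 1 then 1 else 0

theorem bitValue_nonneg (b : ZMod 2) : 0 ≤ bitValue b := by
  unfold bitValue; split_ifs <;> norm_num

theorem bitValue_le_one (b : ZMod 2) : bitValue b ≤ 1 := by
  unfold bitValue; split_ifs <;> norm_num

theorem bitValue_mul_self (b : ZMod 2) : bitValue b * bitValue b = bitValue b := by
  unfold bitValue; split_ifs <;> norm_num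

theorem bitValue_injective : Function.Injective bitValue := by decide

theorem bipolar_eq (b : ZMod 2) : bipolar b = 1 + -2 * (bitValue b : ℝ) := by
  unfold bipolar bitValue; split_ifs <;> norm_num

/-- The number of shifts of `A` that are contained in the support of the signal `x`. -/
def patternCount (A : Finset (ZMod L)) (x : Signal L) : ℤ :=
  ∑ s : ZMod L, ∏ j ∈ A, bitValue (x (s + j))

theorem patternCount_nonneg (A : Finset (ZMod L)) (x : Signal L) : 0 ≤ patternCount A x :=
  Finset.sum_nonneg fun _ _ => Finset.prod_nonneg fun _ _ => bitValue_nonneg _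

theorem mul_moment_eq_sum_patternCount (A : Finset (ZMod L)) (x : Signal L) :
    (L : ℝ) * moment A x = ∑ B ∈ A.powerset, (-2) ^ B.card * (patternCount B x : ℝ) := by
  have hL : (L : ℝ) ≠ 0 := by exact_mod_cast NeZero.ne L
  rw [moment, ← mul_assoc, mul_one_div_cancel hL, one_mul]
  simp only [walsh, bipolar_eq, Finset.prod_one_add, Finset.prod_mul_distrib, Finset.prod_const,
    cyclicShift]
  rw [Finset.sum_comm]
  refine Finset.sum_congr rfl fun B _ => ?_
  rw [patternCount, ← Finset.mul_sum]
  push_cast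
  rfl

/-- The difference of the pattern counts of two signals. -/
def countGap (q : Signal L × Signal L) (A : Finset (ZMod L)) : ℤ :=
  patternCount A q.1 - patternCount A q.2

variable {q : Signal L × Signal L} {k : ℕ}

/-- A sign is 1 - 2 * bit, so moments are triangular in pattern counts; only the full set survives.
-/
theorem mul_momentDiff_eq {A : Finset (ZMod L)} (h : ∀ B ⊂ A, countGap q B = 0) :
    (L : ℝ) * (moment A q.1 - moment A q.2) = (-2) ^ A.card * (countGap q A : ℝ) := by
  rw [mul_sub, mul_moment_eq_sum_patternCount, mul_moment_eq_sum_patternCount,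
    ← Finset.sum_sub_distrib, Finset.sum_eq_single A]
  · rw [countGap]; push_cast; ring
  · intro B hB hne
    have h1 := h B ((Finset.mem_powerset.1 hB).ssubset_of_ne hne)
    rw [countGap, sub_eq_zero] at h1
    rw [h1, sub_self]
  · intro hA; exact absurd (Finset.mem_powerset_self A) hA

theorem countGap_eq_zero (hq : ∀ A : Finset (ZMod L), A.card < k → moment A q.1 = moment A q.2)
    (A : Finset (ZMod L)) : A.card < k → countGap q A = 0 := by
  induction A using Finset.strongInduction with
  | H A ih =>
    intro hA
    have h := mul_momentDiff_eq (q := q) (A := A) fun B hB =>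
      ih B hB ((Finset.card_lt_card hB).trans hA)
    rw [hq A hA, sub_self, mul_zero] at h
    have h2 := (mul_eq_zero.1 h.symm).resolve_left (by positivity)
    exact_mod_cast h2

theorem sq_mul_momentGap_eq
    (hq : ∀ A : Finset (ZMod L), A.card < k → moment A q.1 = moment A q.2) :
    (L : ℝ) ^ 2 * momentGap k q =
      4 ^ k * ((∑ A ∈ Finset.powersetCard k Finset.univ, countGap q A ^ 2 : ℤ) : ℝ) := by
  push_cast
  rw [momentGap, Finset.mul_sum, Finset.mul_sum]
  refine Finset.sum_congr rfl fun A hA => ?_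
  have hcard := (Finset.mem_powersetCard.1 hA).2
  rw [← mul_pow, mul_momentDiff_eq fun B hB =>
    countGap_eq_zero hq B (hcard ▸ Finset.card_lt_card hB), hcard, mul_pow, ← pow_mul,
    mul_comm k 2, pow_mul]
  norm_num

/-- The translate of `A` by `s`. -/
def shiftSet (s : ZMod L) (A : Finset (ZMod L)) : Finset (ZMod L) :=
  Equiv.finsetCongr (Equiv.addLeft s) A

omit [NeZero L] in
theorem card_shiftSet (s : ZMod L) (A : Finset (ZMod L)) : (shiftSet s A).card = A.card :=
  Finset.card_map _

omit [NeZero L] in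
theorem prod_shiftSet (s : ZMod L) (A : Finset (ZMod L)) (f : ZMod L → ℤ) :
    ∏ j ∈ shiftSet s A, f j = ∏ j ∈ A, f (s + j) :=
  Finset.prod_map _ _ _

theorem patternCount_shiftSet (s : ZMod L) (A : Finset (ZMod L)) (x : Signal L) :
    patternCount (shiftSet s A) x = patternCount A x := by
  unfold patternCount
  simp only [prod_shiftSet]
  rw [← Equiv.sum_comp (Equiv.addRight s) fun t => ∏ j ∈ A, bitValue (x (t + j))]
  simp [add_assoc]

theorem countGap_shiftSet (s : ZMod L) (A : Finset (ZMod L)) :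
    countGap q (shiftSet s A) = countGap q A := by
  simp only [countGap, patternCount_shiftSet]

/-- Each shift contributes the same sum when the weight is shift invariant. This divisibility by L
is the arithmetic core of the lower bound. -/
theorem sum_mul_patternCount {w : Finset (ZMod L) → ℤ} (hw : ∀ s A, w (shiftSet s A) = w A)
    (x : Signal L) : ∑ A, w A * patternCount A x = L * ∑ A, w A * ∏ j ∈ A, bitValue (x j) := by
  simp only [patternCount, Finset.mul_sum]
  rw [Finset.sum_comm]
  have : ∀ s : ZMod L, ∑ A, w A * ∏ j ∈ A, bitValue (x (s + j)) =
      ∑ A, w A * ∏ j ∈ A, bitValue (x j) := fun s => by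
    rw [← Equiv.sum_comp (Equiv.finsetCongr (Equiv.addLeft s))
      fun A => w A * ∏ j ∈ A, bitValue (x j)]
    refine Finset.sum_congr rfl fun A _ => ?_
    change _ = w (shiftSet s A) * ∏ j ∈ shiftSet s A, bitValue (x j)
    rw [hw, prod_shiftSet]
  simp only [this, Finset.sum_const, Finset.card_univ, ZMod.card, nsmul_eq_mul, Finset.mul_sum]

theorem sum_mul_countGap {w : Finset (ZMod L) → ℤ} (hw : ∀ s A, w (shiftSet s A) = w A) :
    ∑ A, w A * countGap q A =
      L * ∑ A, w A * (∏ j ∈ A, bitValue (q.1 j) - ∏ j ∈ A, bitValue (q.2 j)) := by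
  simp only [countGap, mul_sub, Finset.sum_sub_distrib, sum_mul_patternCount hw]

theorem prod_bitValue (A : Finset (ZMod L)) (x : Signal L) :
    ∏ j ∈ A, bitValue (x j) = if A ⊆ Finset.univ.filter (fun j => x j = 1) then 1 else 0 := by
  unfold bitValue
  rw [Finset.prod_ite_zero]
  simp [Finset.subset_iff]

theorem sum_prod_bitValue (k : ℕ) (x : Signal L) :
    ∑ A ∈ Finset.powersetCard k Finset.univ, ∏ j ∈ A, bitValue (x j) =
      ((Finset.univ.filter (fun j => x j = 1)).card.choose k : ℤ) := by
  simp only [prod_bitValue]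
  rw [← Finset.sum_filter, Finset.sum_const, nsmul_eq_mul, mul_one, ← Finset.card_powersetCard]
  congr 2
  ext A
  simp [Finset.mem_powersetCard, and_comm]

theorem patternCount_singleton_zero (x : Signal L) :
    patternCount {0} x = ((Finset.univ.filter (fun j => x j = 1)).card : ℤ) := by
  simp [patternCount, bitValue]

theorem sum_powersetCard_eq (k : ℕ) (f : Finset (ZMod L) → ℤ) :
    ∑ A ∈ Finset.powersetCard k Finset.univ, f A = ∑ A, (if A.card = k then 1 else 0) * f A := by
  simp only [ite_mul, one_mul, zero_mul]
  rw [← Finset.sum_filter]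
  congr 1
  ext A
  simp [Finset.mem_powersetCard]

/-- Both signals have equally many ones, hence equally many k-subsets of their supports. -/
theorem sum_countGap_eq_zero (h : countGap q {0} = 0) (k : ℕ) :
    ∑ A ∈ Finset.powersetCard k Finset.univ, countGap q A = 0 := by
  rw [sum_powersetCard_eq, sum_mul_countGap fun s A => by rw [card_shiftSet],
    ← sum_powersetCard_eq, Finset.sum_sub_distrib, sum_prod_bitValue, sum_prod_bitValue]
  rw [countGap, patternCount_singleton_zero, patternCount_singleton_zero, sub_eq_zero] at h
  rw [show _ = _ from Int.natCast_inj.1 h, sub_self, mul_zero]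

/-- Weighting the gaps by their positive parts is shift invariant, so the sum of squares is L times
an integer; being positive, it is at least L. -/
theorem le_sum_max_countGap_sq {A₀ : Finset (ZMod L)} (hA₀ : A₀.card = k)
    (h : 0 < countGap q A₀) :
    (L : ℤ) ≤ ∑ A ∈ Finset.powersetCard k Finset.univ, max (countGap q A) 0 ^ 2 := by
  set w : Finset (ZMod L) → ℤ := fun A => (if A.card = k then 1 else 0) * max (countGap q A) 0
    with hw
  have h1 := sum_mul_countGap (q := q) (w := w) fun s A => by
    simp only [hw, card_shiftSet, countGap_shiftSet]
  have h2 : ∑ A ∈ Finset.powersetCard k Finset.univ, max (countGap q A) 0 ^ 2 =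
      ∑ A, w A * countGap q A := by
    rw [sum_powersetCard_eq]
    refine Finset.sum_congr rfl fun A _ => ?_
    rw [hw, mul_assoc]
    congr 1
    rcases le_total (countGap q A) 0 with h | h
    · simp [max_eq_right h]
    · rw [max_eq_left h, pow_two]
  have h3 : 0 < ∑ A ∈ Finset.powersetCard k Finset.univ, max (countGap q A) 0 ^ 2 := by
    refine Finset.sum_pos' (fun A _ => sq_nonneg _) ⟨A₀, Finset.mem_powersetCard.2
      ⟨Finset.subset_univ _, hA₀⟩, ?_⟩
    rw [max_eq_left h.le]; positivity
  have hL : (0 : ℤ) < L := by exact_mod_cast NeZero.pos L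
  rw [h2, h1] at h3 ⊢
  have := pos_of_mul_pos_right h3 hL.le
  nlinarith

/-- The gaps sum to zero, so both signs occur, and each sign contributes at least L. -/
theorem two_mul_le_sum_countGap_sq (h0 : countGap q {0} = 0) {A₀ : Finset (ZMod L)}
    (hA₀ : A₀.card = k) (h : countGap q A₀ ≠ 0) :
    2 * (L : ℤ) ≤ ∑ A ∈ Finset.powersetCard k Finset.univ, countGap q A ^ 2 := by
  have hmem : ∀ {A : Finset (ZMod L)}, A.card = k → A ∈ Finset.powersetCard k Finset.univ :=
    fun hA => Finset.mem_powersetCard.2 ⟨Finset.subset_univ _, hA⟩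
  have hsum := sum_countGap_eq_zero h0 k
  have hpos : ∃ A : Finset (ZMod L), A.card = k ∧ 0 < countGap q A := by
    by_contra! hcon
    exact h ((Finset.sum_eq_zero_iff_of_nonpos fun A hA =>
      hcon A (Finset.mem_powersetCard.1 hA).2).1 hsum A₀ (hmem hA₀))
  have hneg : ∃ A : Finset (ZMod L), A.card = k ∧ countGap q A < 0 := by
    by_contra! hcon
    exact h ((Finset.sum_eq_zero_iff_of_nonneg fun A hA =>
      hcon A (Finset.mem_powersetCard.1 hA).2).1 hsum A₀ (hmem hA₀))
  obtain ⟨A, hA, hA'⟩ := hpos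
  obtain ⟨B, hB, hB'⟩ := hneg
  have hswap : ∀ C, countGap q.swap C = -countGap q C := fun C => by
    simp [countGap]
  have h1 := le_sum_max_countGap_sq hA hA'
  have h2 := le_sum_max_countGap_sq (q := q.swap) hB (by rw [hswap]; omega)
  rw [two_mul]
  refine (add_le_add h1 h2).trans (le_of_eq ?_)
  rw [← Finset.sum_add_distrib]
  refine Finset.sum_congr rfl fun C _ => ?_
  rw [hswap]
  rcases le_total (countGap q C) 0 with h | h
  · rw [max_eq_right h, max_eq_left (by omega)]; ring
  · rw [max_eq_left h, max_eq_right (by omega)]; ring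

theorem le_momentGap_three (hq : ∀ A : Finset (ZMod L), A.card < 3 → moment A q.1 = moment A q.2)
    {A : Finset (ZMod L)} (hA : A.card = 3) (h : moment A q.1 ≠ moment A q.2) :
    128 / (L : ℝ) ≤ momentGap 3 q := by
  have hL : (0 : ℝ) < L := by exact_mod_cast NeZero.pos L
  have h0 := countGap_eq_zero hq
  have hne : countGap q A ≠ 0 := fun h1 => h <| by
    have h2 := mul_momentDiff_eq (q := q) (A := A) fun B hB =>
      h0 B (hA ▸ Finset.card_lt_card hB)
    rw [h1, Int.cast_zero, mul_zero] at h2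
    exact sub_eq_zero.1 ((mul_eq_zero.1 h2).resolve_left hL.ne')
  have h1 := two_mul_le_sum_countGap_sq (h0 {0} (by simp)) hA hne
  have h2 := sq_mul_momentGap_eq hq
  have h3 : (2 * (L : ℝ)) ≤
      ((∑ A ∈ Finset.powersetCard 3 Finset.univ, countGap q A ^ 2 : ℤ) : ℝ) := by
    exact_mod_cast h1
  rw [div_le_iff₀ hL]
  nlinarith

end PatternCount

/-! ### Mirror pairs and the extremal triple -/

section Reflection

variable {L : ℕ} [NeZero L]

/-- The reflected signal `j ↦ x (c - j)`. -/
def reflect (c : ZMod L) (x : Signal L) : Signal L := fun j => x (c - j)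

/-- Pair correlations are even: s ↦ c - i - j - s exchanges the two factors. Chirality is first
visible at order 3. -/
theorem moment_reflect (c : ZMod L) (x : Signal L) {A : Finset (ZMod L)} (hA : A.card < 3) :
    moment A (reflect c x) = moment A x := by
  have key : ∀ i j : ZMod L, ∑ s, bipolar (x (c - (s + i))) * bipolar (x (c - (s + j))) =
      ∑ s, bipolar (x (s + i)) * bipolar (x (s + j)) := fun i j => by
    rw [← Equiv.sum_comp (Equiv.subLeft (c - i - j))
      fun s => bipolar (x (s + i)) * bipolar (x (s + j))]
    refine Finset.sum_congr rfl fun s _ => ?_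
    rw [mul_comm]
    simp only [Equiv.subLeft_apply]
    congr 3 <;> ring
  unfold moment walsh cyclicShift reflect
  congr 1
  rcases Nat.lt_succ_iff_lt_or_eq.1 hA with h | h
  · rcases Nat.lt_succ_iff_lt_or_eq.1 h with h | h
    · rw [Finset.card_eq_zero.1 (Nat.lt_one_iff.1 h)]; simp
    · obtain ⟨i, rfl⟩ := Finset.card_eq_one.1 h
      simp only [Finset.prod_singleton]
      rw [← Equiv.sum_comp (Equiv.subLeft (c - i - i)) fun s => bipolar (x (s + i))]
      refine Finset.sum_congr rfl fun s _ => ?_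
      simp only [Equiv.subLeft_apply]
      congr 2; ring
  · obtain ⟨i, j, hij, rfl⟩ := Finset.card_eq_two.1 h
    simp only [Finset.prod_pair hij]
    exact key i j

/-- The noise law is reflection invariant and s ↦ -s preserves the uniform shift, so the reflection
moves to the observation. -/
theorem obsProb_reflect (p : ℝ) (c : ZMod L) (x y : Signal L) :
    obsProb p (reflect c x) y = obsProb p x (reflect c y) := by
  rw [obsProb_eq, obsProb_eq, ← Equiv.sum_comp (Equiv.neg (ZMod L))]
  congr 1
  refine Finset.sum_congr rfl fun s _ => ?_
  unfold noiseProb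
  rw [← Equiv.prod_comp (Equiv.subLeft c)]
  refine Finset.prod_congr rfl fun j _ => ?_
  simp only [Pi.sub_apply, cyclicShift, reflect, Equiv.neg_apply, Equiv.subLeft_apply]
  congr 5; ring

omit [NeZero L] in
theorem reflect_reflect (c : ZMod L) (x : Signal L) : reflect c (reflect c x) = x := by
  funext j; simp [reflect]

/-- For a signal and its reflection, the Chernoff information is the Bhattacharyya distance. -/
theorem pairInformation_reflect_le {p : ℝ} (hp0 : 0 < p) (hp1 : p < 1) (c : ZMod L)
    (x : Signal L) : pairInformation p (x, reflect c x) ≤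
      -Real.log (affinity (obsProb p x) (obsProb p (reflect c x)) (1 / 2)) := by
  have hP := obsProb_pos hp0 hp1 x
  have hQ := obsProb_pos hp0 hp1 (reflect c x)
  refine neg_le_neg (Real.log_le_log (affinity_pos hP hQ _) ?_)
  refine affinity_half_le_chernoffCoeff_of_equiv hP hQ (sum_obsProb p _) (sum_obsProb p _)
    ⟨reflect c, reflect c, reflect_reflect c, reflect_reflect c⟩ (fun y => ?_) fun y => ?_
  · exact (obsProb_reflect p c x y).symm
  · change obsProb p (reflect c x) (reflect c y) = obsProb p x y
    rw [obsProb_reflect, reflect_reflect]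

/-- Wraparound as a case split, so that questions on cyclic patterns become linear arithmetic. -/
theorem val_add_natCast (s : ZMod L) {k : ℕ} (hk : k < L) :
    s.val + k < L ∧ (s + (k : ZMod L)).val = s.val + k ∨
      L ≤ s.val + k ∧ (s + (k : ZMod L)).val = s.val + k - L := by
  rw [ZMod.val_add, ZMod.val_natCast, Nat.mod_eq_of_lt hk]
  have := ZMod.val_lt s
  rcases lt_or_ge (s.val + k) L with h | h
  · exact Or.inl ⟨h, Nat.mod_eq_of_lt h⟩
  · exact Or.inr ⟨h, by rw [Nat.mod_eq_sub_mod h, Nat.mod_eq_of_lt (by omega)]⟩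

/-- The indicator of a set of residues, given by their representatives in `[0, L)`. -/
def indicatorSignal (L : ℕ) (S : ℕ → Prop) [DecidablePred S] : Signal L :=
  fun j => if S j.val then 1 else 0

omit [NeZero L] in
theorem indicatorSignal_eq_one {S : ℕ → Prop} [DecidablePred S] {j : ZMod L} :
    indicatorSignal L S j = 1 ↔ S j.val := by
  unfold indicatorSignal; split_ifs with h <;> simp [h]

/-- The indicator of `{0, 1, 3}`. -/
def chiralTriple (L : ℕ) : Signal L := indicatorSignal L fun n => n = 0 ∨ n = 1 ∨ n = 3

omit [NeZero L] in
theorem chiralTriple_eq_one {j : ZMod L} :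
    chiralTriple L j = 1 ↔ j.val = 0 ∨ j.val = 1 ∨ j.val = 3 :=
  indicatorSignal_eq_one

theorem chiralTriple_mem_inequivPairs (hL : 6 ≤ L) :
    (chiralTriple L, reflect 3 (chiralTriple L)) ∈ inequivPairs L := by
  refine mem_inequivPairs.2 fun s h => ?_
  have hv : ∀ k < L, ((k : ℕ) : ZMod L).val = k := fun k hk => ZMod.val_cast_of_lt hk
  -- If the mirror image were the shift by s, then s, s + 2 and s + 3 would all lie in {0, 1, 3}.
  -- This is impossible for L ≥ 6, whereas s = 3 achieves it for L = 5.
  have hx : ∀ i k : ℕ, i + k = 3 → (chiralTriple L ((i : ℕ) : ZMod L) = 1 ↔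
      chiralTriple L (s + (k : ℕ)) = 1) := fun i k hik => by
    have h1 := congrFun h (k : ZMod L)
    have h2 : (3 : ZMod L) - (k : ℕ) = (i : ℕ) := by
      rw [sub_eq_iff_eq_add, ← Nat.cast_add, hik, Nat.cast_ofNat]
    simp only [reflect, cyclicShift, h2] at h1
    rw [h1]
  have hs := ZMod.val_lt s
  have h0 := hx 3 0 rfl
  have h2 := hx 1 2 rfl
  have h3 := hx 0 3 rfl
  have v0 := val_add_natCast s (k := 0) (by omega)
  have v2 := val_add_natCast s (k := 2) (by omega)
  have v3 := val_add_natCast s (k := 3) (by omega)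
  rw [chiralTriple_eq_one, chiralTriple_eq_one, hv _ (by omega)] at h0 h2 h3
  omega

theorem patternCount_chiralTriple_le (hL : 6 ≤ L) :
    patternCount {0, 1, 3} (chiralTriple L) ≤ 1 := by
  have hv : ∀ k < L, ((k : ℕ) : ZMod L).val = k := fun k hk => ZMod.val_cast_of_lt hk
  have hle : ∀ s : ZMod L, ∏ j ∈ ({0, 1, 3} : Finset (ZMod L)), bitValue (chiralTriple L (s + j)) ≤
      if s = 0 then 1 else 0 := fun s => by
    split_ifs with hs
    · exact Finset.prod_le_one (fun _ _ => bitValue_nonneg _) fun _ _ => bitValue_le_one _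
    · refine le_of_eq ?_
      have hs' : s.val ≠ 0 := fun h => hs ((ZMod.val_eq_zero s).1 h)
      have hlt := ZMod.val_lt s
      by_contra hcon
      have h1 : ∀ j ∈ ({0, 1, 3} : Finset (ZMod L)), chiralTriple L (s + j) = 1 := fun j hj => by
        have := Finset.prod_ne_zero_iff.1 hcon j hj
        unfold bitValue at this
        simpa using this
      have e0 := h1 ((0 : ℕ) : ZMod L) (by simp)
      have e1 := h1 ((1 : ℕ) : ZMod L) (by simp)
      have e3 := h1 ((3 : ℕ) : ZMod L) (by simp)
      have v0 := val_add_natCast s (k := 0) (by omega)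
      have v1 := val_add_natCast s (k := 1) (by omega)
      have v3 := val_add_natCast s (k := 3) (by omega)
      rw [chiralTriple_eq_one] at e0 e1 e3
      omega
  calc _ ≤ ∑ s : ZMod L, (if s = 0 then 1 else 0 : ℤ) := Finset.sum_le_sum fun s _ => hle s
    _ = 1 := by simp

omit [NeZero L] in
theorem natCast_injOn_lt {a b : ℕ} (ha : a < L) (hb : b < L) :
    ((a : ZMod L) = (b : ZMod L)) ↔ a = b := by
  rw [ZMod.natCast_eq_natCast_iff', Nat.mod_eq_of_lt ha, Nat.mod_eq_of_lt hb]

/-- The only 3-subset of a three-point support is the support itself. Weighting the gaps by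
themselves thus gives L * (gap at S - gap at S'), and each count of a support in its own signal is
at most 1, so the sum of squares is at most 2L. -/
theorem momentGap_chiralTriple_le (hL : 6 ≤ L) :
    momentGap 3 (chiralTriple L, reflect 3 (chiralTriple L)) ≤ 128 / (L : ℝ) := by
  set x := chiralTriple L with hx
  set q : Signal L × Signal L := (x, reflect 3 x) with hqdef
  have hLpos : (0 : ℝ) < L := by exact_mod_cast NeZero.pos L
  have hq : ∀ A : Finset (ZMod L), A.card < 3 → moment A q.1 = moment A q.2 :=
    fun A hA => (moment_reflect 3 x hA).symm
  have hne : ∀ a b : ℕ, a < 6 → b < 6 → a ≠ b → (a : ZMod L) ≠ (b : ZMod L) :=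
    fun a b ha hb hab h => hab ((natCast_injOn_lt (by omega) (by omega)).1 h)
  have h01 : (0 : ZMod L) ≠ 1 := by exact_mod_cast hne 0 1 (by omega) (by omega) (by omega)
  have h03 : (0 : ZMod L) ≠ 3 := by exact_mod_cast hne 0 3 (by omega) (by omega) (by omega)
  have h13 : (1 : ZMod L) ≠ 3 := by exact_mod_cast hne 1 3 (by omega) (by omega) (by omega)
  set S : Finset (ZMod L) := {0, 1, 3} with hS
  have hScard : S.card = 3 := Finset.card_eq_three.2 ⟨0, 1, 3, h01, h03, h13, rfl⟩
  have hv : ∀ k < L, ((k : ℕ) : ZMod L).val = k := fun k hk => ZMod.val_cast_of_lt hk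
  have hsupp : Finset.univ.filter (fun j => x j = 1) = S := by
    ext j
    have hj : ∀ k : ℕ, k < 6 → (j = (k : ZMod L) ↔ j.val = k) := fun k hk => by
      constructor
      · rintro rfl; exact hv k (by omega)
      · intro h; rw [← h, ZMod.natCast_zmod_val]
    have e0 := hj 0 (by omega)
    have e1 := hj 1 (by omega)
    have e3 := hj 3 (by omega)
    push_cast at e0 e1 e3
    simp only [Finset.mem_filter, Finset.mem_univ, true_and, hx, chiralTriple_eq_one, hS,
      Finset.mem_insert, Finset.mem_singleton, e0, e1, e3]
  set S' : Finset (ZMod L) := S.map (Equiv.subLeft 3).toEmbedding with hS'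
  have hS'card : S'.card = 3 := (Finset.card_map _).trans hScard
  have hsupp' : Finset.univ.filter (fun j => reflect 3 x j = 1) = S' := by
    ext j
    rw [Finset.mem_filter, hS', Finset.mem_map_equiv, Equiv.subLeft_symm_apply, neg_add_eq_sub,
      ← hsupp, Finset.mem_filter]
    simp only [Finset.mem_univ, true_and, reflect]
  have hpc : patternCount S' (reflect 3 x) = patternCount S x := by
    unfold patternCount
    rw [← Equiv.sum_comp (Equiv.neg _) fun s => ∏ j ∈ S, bitValue (x (s + j))]
    refine Finset.sum_congr rfl fun s _ => ?_
    rw [hS', Finset.prod_map]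
    refine Finset.prod_congr rfl fun j _ => ?_
    simp only [reflect, Equiv.coe_toEmbedding, Equiv.subLeft_apply, Equiv.neg_apply]
    congr 2; ring
  have hone : ∀ (T : Finset (ZMod L)), T.card = 3 → ∀ A : Finset (ZMod L),
      (if A.card = 3 then (1 : ℤ) else 0) * countGap q A * (if A ⊆ T then 1 else 0) =
      if A = T then countGap q A else 0 := fun T hT A => by
    by_cases hAT : A = T
    · subst hAT; simp [hT]
    · rw [if_neg hAT]
      by_cases hA : A.card = 3
      · rw [if_neg (fun h => hAT (Finset.eq_of_subset_of_card_le h (by omega))), mul_zero]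
      · rw [if_neg hA]; ring
  have hsum : ∑ A ∈ Finset.powersetCard 3 Finset.univ, countGap q A ^ 2 =
      L * (countGap q S - countGap q S') := by
    rw [sum_powersetCard_eq]
    have := sum_mul_countGap (q := q)
      (w := fun A => (if A.card = 3 then 1 else 0) * countGap q A) fun s A => by
        simp only [card_shiftSet, countGap_shiftSet]
    simp only [pow_two, ← mul_assoc]
    rw [this]
    congr 1
    simp only [hqdef, prod_bitValue, hsupp, hsupp', mul_sub, Finset.sum_sub_distrib]
    simp only [← hqdef, hone S hScard, hone S' hS'card, Finset.sum_ite_eq', Finset.mem_univ,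
      if_true]
  have hle : countGap q S - countGap q S' ≤ 2 := by
    have h1 : patternCount S x ≤ 1 := patternCount_chiralTriple_le hL
    have h2 := patternCount_nonneg S (reflect 3 x)
    have h3 := patternCount_nonneg S' x
    simp only [countGap, hqdef, hpc]
    omega
  have h2 := sq_mul_momentGap_eq hq
  have h3 : ((∑ A ∈ Finset.powersetCard 3 Finset.univ, countGap q A ^ 2 : ℤ) : ℝ) ≤ L * 2 := by
    rw [hsum]; push_cast; gcongr; exact_mod_cast hle
  rw [le_div_iff₀ hLpos]
  nlinarith

end Reflection

/-! ### Even length: mirror pairs with equal moments up to order 3 -/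

section Antiperiodic

variable {L : ℕ} [NeZero L]

/-- Shifting by `u` complements the signal, which reverses the sign of Walsh functions of odd order,
so the average over shifts cancels. -/
theorem moment_eq_zero_of_antiperiodic {x : Signal L} {u : ZMod L} (h : ∀ j, x (u + j) = x j + 1)
    {A : Finset (ZMod L)} (hA : Odd A.card) : moment A x = 0 := by
  have h1 : ∀ s, walsh A (cyclicShift (u + s) x) = -walsh A (cyclicShift s x) := fun s => by
    have h2 : cyclicShift (u + s) x = cyclicShift s x + 1 := by
      funext j; simp [cyclicShift, add_assoc, h]
    rw [h2, walsh_add, walsh_one, hA.neg_one_pow, mul_neg_one]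
  have h3 := Equiv.sum_comp (Equiv.addLeft u) fun s => walsh A (cyclicShift s x)
  simp only [Equiv.coe_addLeft, h1, Finset.sum_neg_distrib] at h3
  rw [moment, show ∑ s, walsh A (cyclicShift s x) = 0 by linarith, mul_zero]

/-- The antiperiodic signal of length `2 * m` with cyclic run lengths
`1, 2, m - 3, 1, 2, m - 3`. -/
def chiralAntiperiodic (L m : ℕ) : Signal L :=
  indicatorSignal L fun n => n = 0 ∨ (3 ≤ n ∧ n < m) ∨ n = m + 1 ∨ n = m + 2

omit [NeZero L] in
theorem chiralAntiperiodic_eq_one {m : ℕ} {j : ZMod L} : chiralAntiperiodic L m j = 1 ↔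
    j.val = 0 ∨ (3 ≤ j.val ∧ j.val < m) ∨ j.val = m + 1 ∨ j.val = m + 2 :=
  indicatorSignal_eq_one

theorem chiralAntiperiodic_add {m : ℕ} (hm : 6 ≤ m) (hL : L = 2 * m) (j : ZMod L) :
    chiralAntiperiodic L m ((m : ZMod L) + j) = chiralAntiperiodic L m j + 1 := by
  have hiff : ∀ a b : ZMod 2, (a = 1 ↔ ¬b = 1) → a = b + 1 := by decide
  apply hiff
  rw [add_comm, chiralAntiperiodic_eq_one, chiralAntiperiodic_eq_one]
  have := val_add_natCast j (k := m) (by omega)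
  have := ZMod.val_lt j
  omega

theorem chiralAntiperiodic_mem_inequivPairs {m : ℕ} (hm : 6 ≤ m) (hL : L = 2 * m) :
    (chiralAntiperiodic L m, reflect 3 (chiralAntiperiodic L m)) ∈ inequivPairs L := by
  refine mem_inequivPairs.2 fun s h => ?_
  have hv : ∀ k < L, ((k : ℕ) : ZMod L).val = k := fun k hk => ZMod.val_cast_of_lt hk
  -- The mirror image reads 1, 0, 0, 1, 0 at positions 0 to 4. In the signal the only run of exactly
  -- two zeros is followed by m - 3 ≥ 3 ones, so this window occurs nowhere. For m = 5 it would
  -- occur.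
  have hx : ∀ i k : ℕ, ((i + k : ℕ) : ZMod L) = 3 → (chiralAntiperiodic L m ((i : ℕ) : ZMod L) = 1 ↔
      chiralAntiperiodic L m (s + (k : ℕ)) = 1) := fun i k hik => by
    have h1 := congrFun h (k : ZMod L)
    have h2 : (3 : ZMod L) - (k : ℕ) = (i : ℕ) := by
      rw [sub_eq_iff_eq_add, ← Nat.cast_add, hik]
    simp only [reflect, cyclicShift, h2] at h1
    rw [h1]
  have hs := ZMod.val_lt s
  have h0 := hx 3 0 (by norm_num)
  have h1 := hx 2 1 (by norm_num)
  have h2 := hx 1 2 (by norm_num)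
  have h3 := hx 0 3 (by norm_num)
  have h4 := hx (L - 1) 4 (by rw [show L - 1 + 4 = L + 3 by omega]; simp)
  have v0 := val_add_natCast s (k := 0) (by omega)
  have v1 := val_add_natCast s (k := 1) (by omega)
  have v2 := val_add_natCast s (k := 2) (by omega)
  have v3 := val_add_natCast s (k := 3) (by omega)
  have v4 := val_add_natCast s (k := 4) (by omega)
  rw [chiralAntiperiodic_eq_one, chiralAntiperiodic_eq_one, hv _ (by omega)] at h0 h1 h2 h3 h4
  omega

theorem moment_reflect_chiralAntiperiodic {m : ℕ} (hm : 6 ≤ m) (hL : L = 2 * m)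
    {A : Finset (ZMod L)} (hA : A.card < 4) :
    moment A (chiralAntiperiodic L m) = moment A (reflect 3 (chiralAntiperiodic L m)) := by
  rcases Nat.lt_succ_iff_lt_or_eq.1 hA with h | h
  · exact (moment_reflect 3 _ h).symm
  have hodd : Odd A.card := h ▸ by decide
  have hmm : (m : ZMod L) + m = 0 := by
    rw [← Nat.cast_add, ← two_mul, ← hL, ZMod.natCast_self]
  rw [moment_eq_zero_of_antiperiodic (chiralAntiperiodic_add hm hL) hodd,
    moment_eq_zero_of_antiperiodic (u := (m : ZMod L)) (fun j => ?_) hodd]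
  unfold reflect
  rw [← chiralAntiperiodic_add hm hL]
  congr 1
  -- Reflection turns the antiperiod m into -m, which is the same residue.
  linear_combination (-1 : ZMod L) * hmm

end Antiperiodic

/-! ### Prime length: the bispectrum determines the shift class -/

section Bispectrum

open ZMod

variable {L : ℕ} [NeZero L]

/-- The discrete Fourier transform of a Boolean signal. -/
noncomputable def signalDFT (x : Signal L) : ZMod L → ℂ := dft fun j => (bitValue (x j) : ℂ)

theorem signalDFT_apply (x : Signal L) (k : ZMod L) :
    signalDFT x k = ∑ j, stdAddChar (-(j * k)) * (bitValue (x j) : ℂ) := by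
  simp only [signalDFT, dft_apply, smul_eq_mul]

theorem signalDFT_injective : Function.Injective (signalDFT (L := L)) := fun x y h => by
  have h1 := (dft (N := L) (E := ℂ)).injective h
  funext j
  exact bitValue_injective (by exact_mod_cast congrFun h1 j)

theorem prod_insert_of_idempotent {ι : Type*} [DecidableEq ι] {f : ι → ℤ}
    (hf : ∀ i, f i * f i = f i) (i : ι) (A : Finset ι) :
    ∏ j ∈ insert i A, f j = f i * ∏ j ∈ A, f j := by
  by_cases hi : i ∈ A
  · rw [Finset.insert_eq_of_mem hi, ← Finset.mul_prod_erase A f hi, ← mul_assoc, hf]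
  · exact Finset.prod_insert hi

/-- Bits are idempotent, so the formula survives coincidences among 0, a, c; this is why counts of
order below 3 are needed too. -/
theorem patternCount_triple (x : Signal L) (a c : ZMod L) : patternCount {0, a, c} x =
    ∑ s, bitValue (x s) * bitValue (x (s + a)) * bitValue (x (s + c)) := by
  refine Finset.sum_congr rfl fun s _ => ?_
  rw [prod_insert_of_idempotent fun _ => bitValue_mul_self _,
    prod_insert_of_idempotent fun _ => bitValue_mul_self _, Finset.prod_singleton, add_zero,
    mul_assoc]

/-- The bispectrum is the Fourier transform of the triple correlation. -/
theorem bispectrum_eq (x : Signal L) (k l : ZMod L) :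
    signalDFT x k * signalDFT x l * signalDFT x (-(k + l)) =
      ∑ a, ∑ c, stdAddChar (-(a * k + c * l)) * (patternCount {0, a, c} x : ℂ) := by
  have hshift : ∀ (s k : ZMod L), signalDFT x k =
      ∑ a, stdAddChar (-((s + a) * k)) * (bitValue (x (s + a)) : ℂ) := fun s k => by
    rw [signalDFT_apply, ← Equiv.sum_comp (Equiv.addLeft s)]
    rfl
  rw [signalDFT_apply x (-(k + l)), Finset.mul_sum]
  have h1 : ∀ s, signalDFT x k * signalDFT x l *
      (stdAddChar (-(s * -(k + l))) * (bitValue (x s) : ℂ)) =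
      ∑ a, ∑ c, stdAddChar (-(a * k + c * l)) *
        ((bitValue (x s) : ℂ) * bitValue (x (s + a)) * bitValue (x (s + c))) := fun s => by
    rw [hshift s k, hshift s l, Finset.sum_mul_sum, Finset.sum_mul]
    refine Finset.sum_congr rfl fun a _ => ?_
    rw [Finset.sum_mul]
    refine Finset.sum_congr rfl fun c _ => ?_
    have h2 : -(a * k + c * l) = -((s + a) * k) + -((s + c) * l) + -(s * -(k + l)) := by ring
    rw [h2, AddChar.map_add_eq_mul, AddChar.map_add_eq_mul]
    ring
  simp only [h1]
  rw [Finset.sum_comm]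
  refine Finset.sum_congr rfl fun a _ => ?_
  rw [Finset.sum_comm]
  refine Finset.sum_congr rfl fun c _ => ?_
  rw [← Finset.mul_sum, patternCount_triple]
  push_cast
  rfl

theorem signalDFT_cyclicShift (s : ZMod L) (x : Signal L) (k : ZMod L) :
    signalDFT (cyclicShift s x) k = stdAddChar (s * k) * signalDFT x k := by
  rw [signalDFT_apply, signalDFT_apply, ← Equiv.sum_comp (Equiv.addLeft s)
    fun j => stdAddChar (-(j * k)) * (bitValue (x j) : ℂ), Finset.mul_sum]
  refine Finset.sum_congr rfl fun j _ => ?_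
  have h : -(j * k) = s * k + -((s + j) * k) := by ring
  rw [h, AddChar.map_add_eq_mul, Equiv.coe_addLeft]
  simp only [cyclicShift]
  ring

theorem isPrimitiveRoot_stdAddChar (hL : L.Prime) {k : ZMod L} (hk : k ≠ 0) :
    IsPrimitiveRoot (stdAddChar k : ℂ) L := by
  have : Fact L.Prime := ⟨hL⟩
  have h1 : (stdAddChar k : ℂ) ^ L = 1 := by
    rw [← AddChar.map_nsmul_eq_pow, nsmul_eq_mul, ZMod.natCast_self, zero_mul,
      AddChar.map_zero_eq_one]
  have h2 : (stdAddChar k : ℂ) ≠ 1 := fun h =>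
    hk (injective_stdAddChar (h.trans (AddChar.map_zero_eq_one _).symm))
  exact IsPrimitiveRoot.iff_orderOf.2 (orderOf_eq_prime h1 h2)

open Polynomial in
-- The minimal polynomial of η has degree L - 1 and all coefficients 1, so a rational polynomial of
-- degree at most L - 1 vanishing at η is a constant multiple of it.
theorem eq_of_sum_pow_eq_zero (hL : L.Prime) {η : ℂ} (hη : IsPrimitiveRoot η L) (b : ZMod L → ℤ)
    (h : ∑ j, η ^ j.val * (b j : ℂ) = 0) (i j : ZMod L) : b i = b j := by
  have : Fact L.Prime := ⟨hL⟩
  set f : ℚ[X] := ∑ j : ZMod L, monomial j.val (b j : ℚ) with hf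
  have hcoeff : ∀ j : ZMod L, f.coeff j.val = b j := fun j => by
    rw [hf, finsetSum_coeff, Finset.sum_eq_single j]
    · simp
    · intro i _ hij
      rw [coeff_monomial, if_neg fun h => hij (ZMod.val_injective L h)]
    · simp
  have hroot : aeval η f = 0 := by
    rw [← h, hf, map_sum]
    refine Finset.sum_congr rfl fun j _ => ?_
    rw [aeval_monomial]
    simp [mul_comm]
  obtain ⟨r, hr⟩ : cyclotomic L ℚ ∣ f := by
    rw [cyclotomic_eq_minpoly_rat hη hL.pos]
    exact minpoly.dvd ℚ η hroot
  have hdeg : f.natDegree ≤ L - 1 := by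
    refine natDegree_sum_le_of_forall_le _ _ fun j _ => ?_
    exact (natDegree_monomial_le _).trans (Nat.le_sub_one_of_lt (ZMod.val_lt j))
  have hconst : ∃ c, r = C c := by
    by_cases hr0 : r = 0
    · exact ⟨0, by rw [hr0, C_0]⟩
    · refine ⟨r.coeff 0, eq_C_of_natDegree_eq_zero ?_⟩
      rw [hr, natDegree_mul (cyclotomic_ne_zero L ℚ) hr0, natDegree_cyclotomic,
        Nat.totient_prime hL] at hdeg
      omega
  obtain ⟨c, rfl⟩ := hconst
  have hall : ∀ j : ZMod L, (b j : ℚ) = c := fun j => by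
    rw [← hcoeff j, hr, coeff_mul_C, cyclotomic_prime, finsetSum_coeff]
    simp [coeff_X_pow, ZMod.val_lt j]
  exact_mod_cast (hall i).trans (hall j).symm

theorem signalDFT_ne_zero (hL : L.Prime) {x : Signal L} {i j : ZMod L} (hx : x i ≠ x j)
    (k : ZMod L) : signalDFT x k ≠ 0 := fun h => by
  refine hx (bitValue_injective ?_)
  rw [signalDFT_apply] at h
  by_cases hk : k = 0
  · have h1 : ∑ j, bitValue (x j) = 0 := by
      simp only [hk, mul_zero, neg_zero, AddChar.map_zero_eq_one, one_mul] at h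
      exact_mod_cast h
    have h2 := (Finset.sum_eq_zero_iff_of_nonneg fun j _ => bitValue_nonneg (x j)).1 h1
    rw [h2 i (Finset.mem_univ i), h2 j (Finset.mem_univ j)]
  · refine eq_of_sum_pow_eq_zero hL (isPrimitiveRoot_stdAddChar hL (neg_ne_zero.2 hk))
      (fun j => bitValue (x j)) ?_ i j
    rw [← h]
    refine Finset.sum_congr rfl fun j _ => ?_
    rw [← AddChar.map_nsmul_eq_pow, nsmul_eq_mul, ZMod.natCast_zmod_val, mul_neg]

theorem signalDFT_zero (x : Signal L) : signalDFT x 0 = (patternCount {0} x : ℂ) := by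
  rw [signalDFT_apply, patternCount]
  simp

/-- For prime length, the triple correlation determines a Boolean signal up to cyclic shifts. -/
theorem exists_eq_cyclicShift (hL : L.Prime) {x x' : Signal L}
    (h : ∀ A : Finset (ZMod L), A.card < 4 → patternCount A x = patternCount A x') :
    ∃ s : ZMod L, x' = cyclicShift s x := by
  have h0 := h {0} (by simp)
  -- Constant signals have vanishing Fourier coefficients, so they are identified by their number of
  -- ones instead.
  by_cases hconst : ∀ j, x j = x 0
  · refine ⟨0, ?_⟩
    rw [cyclicShift_zero]
    have hsum : ∀ y : Signal L, patternCount {0} y = ∑ j, bitValue (y j) := fun y => by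
      simp [patternCount]
    rw [hsum, hsum] at h0
    simp only [hconst] at h0
    funext j
    rw [hconst j]
    refine bitValue_injective ?_
    rcases (bitValue_nonneg (x 0)).eq_or_lt with hx | hx
    · rw [← hx, Finset.sum_const_zero] at h0
      rw [← hx, (Finset.sum_eq_zero_iff_of_nonneg fun j _ => bitValue_nonneg (x' j)).1 h0.symm j
        (Finset.mem_univ j)]
    · have hx1 : bitValue (x 0) = 1 := le_antisymm (bitValue_le_one _) hx
      rw [hx1] at h0 ⊢
      exact ((Finset.sum_eq_sum_iff_of_le fun j _ => bitValue_le_one (x' j)).1 h0.symm j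
        (Finset.mem_univ j))
  push Not at hconst
  obtain ⟨j, hj⟩ := hconst
  have hne := signalDFT_ne_zero hL hj
  have hbi : ∀ k l, signalDFT x' k * signalDFT x' l * signalDFT x' (-(k + l)) =
      signalDFT x k * signalDFT x l * signalDFT x (-(k + l)) := fun k l => by
    rw [bispectrum_eq, bispectrum_eq]
    refine Finset.sum_congr rfl fun a _ => Finset.sum_congr rfl fun c _ => ?_
    rw [h _ (Finset.card_le_three.trans_lt (by norm_num))]
  -- Equal bispectra make the ratio `u` of the transforms a character of the cyclic group. Its value
  -- at 1 is an L-th root of unity, and a character of this form is the effect of a shift.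
  set u : ZMod L → ℂ := fun k => signalDFT x' k / signalDFT x k with hu
  have hu3 : ∀ k l, u k * u l * u (-(k + l)) = 1 := fun k l => by
    rw [hu]
    simp only [div_mul_div_comm]
    rw [hbi]
    exact div_self (mul_ne_zero (mul_ne_zero (hne k) (hne l)) (hne _))
  have hu0 : u 0 = 1 := by
    rw [hu]
    simp only
    rw [signalDFT_zero x', ← h0, ← signalDFT_zero]
    exact div_self (hne 0)
  have huneg : ∀ k, u k * u (-k) = 1 := fun k => by
    have := hu3 k 0
    rwa [hu0, mul_one, add_zero] at this
  have huadd : ∀ k l, u (k + l) = u k * u l := fun k l => by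
    have h1 := hu3 k l
    have h2 := huneg (k + l)
    have h3 : u (-(k + l)) ≠ 0 := right_ne_zero_of_mul_eq_one h2
    exact mul_right_cancel₀ h3 (h2.trans h1.symm)
  have hunat : ∀ n : ℕ, u (n : ZMod L) = u 1 ^ n := fun n => by
    induction n with
    | zero => simpa using hu0
    | succ n ih => rw [Nat.cast_succ, huadd, ih, pow_succ]
  have hroot : u 1 ^ L = 1 := by rw [← hunat, ZMod.natCast_self, hu0]
  have h10 : (1 : ZMod L) ≠ 0 := by
    have : Fact L.Prime := ⟨hL⟩
    exact one_ne_zero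
  obtain ⟨c, -, hc⟩ := (isPrimitiveRoot_stdAddChar hL h10).eq_pow_of_pow_eq_one hroot
  refine ⟨(c : ZMod L), signalDFT_injective (funext fun k => ?_)⟩
  rw [signalDFT_cyclicShift, ← div_eq_iff (hne k)]
  change u k = _
  rw [← ZMod.natCast_zmod_val k, hunat, ← hc, ← AddChar.map_nsmul_eq_pow,
    ← AddChar.map_nsmul_eq_pow]
  congr 1
  simp only [nsmul_eq_mul]
  ring

theorem exists_moment_ne (hL : L.Prime) {q : Signal L × Signal L} (hq : q ∈ inequivPairs L) :
    ∃ A : Finset (ZMod L), A.card < 4 ∧ moment A q.1 ≠ moment A q.2 := by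
  by_contra! hcon
  obtain ⟨s, hs⟩ := exists_eq_cyclicShift hL fun A hA => sub_eq_zero.1 (countGap_eq_zero hcon A hA)
  exact mem_inequivPairs.1 hq s hs

end Bispectrum

/-! ### Assembly of the two asymptotic laws -/

section Exponent

variable {L : ℕ} [NeZero L]

/-- With k the first order at which the moments differ, k ≤ 2 gives information of order SNR^k,
which dominates the cubic term near 1/2, and k = 3 invokes the bound 128 / L on the gap. -/
theorem exists_le_pairInformation {q : Signal L × Signal L}
    (hq : ∃ A : Finset (ZMod L), A.card < 4 ∧ moment A q.1 ≠ moment A q.2) :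
    ∃ K : ℝ, ∀ᶠ p in 𝓝 (1 / 2),
      2 ^ 10 / (L : ℝ) * snr p ^ 3 - K * snr p ^ 4 ≤ pairInformation p q := by
  classical
  have hL : (0 : ℝ) < L := by exact_mod_cast NeZero.pos L
  have hex : ∃ k : ℕ, ∃ A : Finset (ZMod L), A.card = k ∧ moment A q.1 ≠ moment A q.2 := by
    obtain ⟨A, -, hA⟩ := hq
    exact ⟨A.card, A, rfl, hA⟩
  obtain ⟨A, hAk, hA⟩ := Nat.find_spec hex
  have hk3 : Nat.find hex ≤ 3 := by
    obtain ⟨B, hB4, hB⟩ := hq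
    exact (Nat.find_min' hex ⟨B, rfl, hB⟩).trans (by omega)
  have hlt : ∀ B : Finset (ZMod L), B.card < Nat.find hex → moment B q.1 = moment B q.2 :=
    fun B hB => by
      by_contra hne
      exact Nat.find_min hex hB ⟨B, rfl, hne⟩
  have hk1 : 1 ≤ Nat.find hex := by
    rw [← hAk, Nat.one_le_iff_ne_zero]
    intro h0
    rw [Finset.card_eq_zero.1 h0, moment_empty, moment_empty] at hA
    exact hA rfl
  generalize Nat.find hex = k at *
  have hnear := eventually_near_half (L := L)
  rcases hk3.lt_or_eq with hk | rfl
  · have hgap : 0 < momentGap k q :=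
      Finset.sum_pos' (fun _ _ => sq_nonneg _) ⟨A, Finset.mem_powersetCard.2
        ⟨Finset.subset_univ _, hAk⟩, pow_pos (abs_pos.2 (sub_ne_zero.2 hA)) 2 |>.trans_eq
          (sq_abs _)⟩
    refine ⟨0, ?_⟩
    have hlim : Tendsto (fun p => (8 ^ L * 4 ^ (k + 1) + 2 ^ 10 / (L : ℝ)) * snr p) (𝓝 (1 / 2))
        (𝓝 0) := by
      have : Continuous fun p => (8 ^ L * 4 ^ (k + 1) + 2 ^ 10 / (L : ℝ)) * snr p := by
        unfold snr; fun_prop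
      simpa [snr] using this.tendsto (1 / 2)
    filter_upwards [hnear, hlim.eventually (ge_mem_nhds (show 0 < 4 ^ k * momentGap k q / 8 by
      positivity))] with p ⟨hp0, hp1, _, hs1⟩ hle
    refine le_trans ?_ (le_pairInformation hp0 hp1 hlt)
    have hs0 := snr_nonneg p
    have h1 : snr p ^ 3 ≤ snr p ^ (k + 1) := pow_le_pow_of_le_one hs0 hs1 (by omega)
    have h2 := mul_le_mul_of_nonneg_left h1 (show 0 ≤ 2 ^ 10 / (L : ℝ) by positivity)
    have h3 := mul_le_mul_of_nonneg_left hle (pow_nonneg hs0 k)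
    rw [mul_pow, mul_pow]
    rw [pow_succ (snr p) k] at h2 ⊢
    linarith
  · have hgap := le_momentGap_three hlt hAk hA
    refine ⟨8 ^ L * 4 ^ 4, ?_⟩
    filter_upwards [hnear] with p ⟨hp0, hp1, _, _⟩
    refine le_trans ?_ (le_pairInformation hp0 hp1 hlt)
    have h1 := mul_le_mul_of_nonneg_left hgap (show 0 ≤ (4 * snr p) ^ 3 / 8 from
      div_nonneg (pow_nonneg (mul_nonneg (by norm_num) (snr_nonneg p)) 3) (by norm_num))
    have h2 : (4 * snr p) ^ 3 / 8 * (128 / (L : ℝ)) = 2 ^ 10 / (L : ℝ) * snr p ^ 3 := by ring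
    rw [h2] at h1
    have h3 : (4 * snr p) ^ (3 + 1) = 4 ^ 4 * snr p ^ 4 := by ring
    rw [h3]
    linarith

/-- The lower bound is uniform because there are finitely many pairs; the upper bound comes from the
chiral triple and its mirror image. -/
theorem cubicExponent_mapExponent (hL : 6 ≤ L)
    (h : ∀ q ∈ inequivPairs L, ∃ A : Finset (ZMod L), A.card < 4 ∧ moment A q.1 ≠ moment A q.2) :
    CubicExponent L (mapExponent L) := by
  choose! K hK using fun q hq => exists_le_pairInformation (h q hq)
  obtain ⟨M, hM⟩ := exists_neg_log_affinity_half_le (L := L) (k := 3)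
    (q := (chiralTriple L, reflect 3 (chiralTriple L))) (by norm_num)
    fun A hA => (moment_reflect 3 _ hA).symm
  refine IsBigO.of_bound (∑ q ∈ inequivPairs L, |K q| + |M|) ?_
  filter_upwards [(Finset.eventually_all (inequivPairs L)).2 hK, hM,
    eventually_near_half (L := L)] with p hlow hup ⟨hp0, hp1, _, _⟩
  have hs0 := snr_nonneg p
  have hs4 : 0 ≤ snr p ^ 4 := by positivity
  have hsum : 0 ≤ ∑ q ∈ inequivPairs L, |K q| := Finset.sum_nonneg fun _ _ => abs_nonneg _
  rw [Real.norm_eq_abs, Real.norm_eq_abs, abs_of_nonneg hs4, add_mul, abs_le]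
  constructor
  · obtain ⟨q, hq, hE⟩ := exists_mapExponent_eq L p
    have h1 := hlow q hq
    have h2 : K q ≤ ∑ q ∈ inequivPairs L, |K q| := (le_abs_self _).trans
      (Finset.single_le_sum (f := fun q => |K q|) (fun _ _ => abs_nonneg _) hq)
    have h3 := mul_le_mul_of_nonneg_right h2 hs4
    rw [← hE] at h1
    linarith [mul_nonneg (abs_nonneg M) hs4]
  · have h1 := (mapExponent_le (p := p) (chiralTriple_mem_inequivPairs hL)).trans
      ((pairInformation_reflect_le hp0 hp1 3 _).trans hup)
    have h2 := mul_le_mul_of_nonneg_left (momentGap_chiralTriple_le hL)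
      (show 0 ≤ (4 * snr p) ^ 3 / 8 by positivity)
    have h3 : (4 * snr p) ^ 3 / 8 * (128 / (L : ℝ)) = 2 ^ 10 / (L : ℝ) * snr p ^ 3 := by ring
    have h4 := mul_le_mul_of_nonneg_right (le_abs_self M) hs4
    rw [h3] at h2
    linarith [mul_nonneg hsum hs4]

theorem quarticExponent_mapExponent {q : Signal L × Signal L} (hq : q ∈ inequivPairs L)
    (h : ∀ A : Finset (ZMod L), A.card < 4 → moment A q.1 = moment A q.2) :
    QuarticExponent (mapExponent L) := by
  obtain ⟨M, hM⟩ := exists_neg_log_affinity_half_le (by norm_num) h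
  refine IsBigO.of_bound (2 * (4 ^ 4 * momentGap 4 q / 8 + |M|)) ?_
  filter_upwards [hM, eventually_near_half (L := L)] with p hup ⟨hp0, hp1, _, hs1⟩
  have hs0 := snr_nonneg p
  have hs4 : 0 ≤ snr p ^ 4 := by positivity
  have h0 : 0 ≤ mapExponent L p := by
    obtain ⟨q', -, hE⟩ := exists_mapExponent_eq L p
    exact hE ▸ pairInformation_nonneg hp0 hp1 q'
  rw [Real.norm_of_nonneg h0, Real.norm_of_nonneg hs4]
  have h1 := (mapExponent_le (p := p) hq).trans (pairInformation_le_two_mul hp0 hp1 q)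
  have h2 : M * snr p ^ (4 + 1) ≤ |M| * snr p ^ 4 :=
    mul_le_mul (le_abs_self M) (pow_le_pow_of_le_one hs0 hs1 (by norm_num)) (by positivity)
      (abs_nonneg M)
  have h3 : (4 * snr p) ^ 4 * momentGap 4 q / 8 = 4 ^ 4 * momentGap 4 q / 8 * snr p ^ 4 := by ring
  rw [h3] at hup
  calc _ ≤ _ := h1.trans (mul_le_mul_of_nonneg_left (hup.trans (add_le_add_right h2 _)) two_pos.le)
    _ = _ := by ring

end Exponent

/-- The error exponent of MAP for Boolean multireference alignment with `L ≥ 6`, uniform shifts,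
no deletions, and one signal per shift class: it is a function `E` of `p` alone (it depends
neither on the choice of the representatives nor on the prior). -/
theorem corollary1 (L : ℕ) [NeZero L] (hL : 6 ≤ L) :
    ∃ E : ℝ → ℝ,
      (∀ X : Set (Signal L), IsShiftTransversal X →
        ∀ P : Signal L → ℝ, P ∈ stdSimplex ℝ (Signal L) → Function.support P = X →
          ∀ p : ℝ, 0 < p → p < 1 → IsMAPErrorExponent P p (E p)) ∧
      (CubicExponent L E ∨ QuarticExponent E) ∧
      (L.Prime → CubicExponent L E) ∧
      (12 ≤ L → Even L → QuarticExponent E) := by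
  refine ⟨mapExponent L, fun X hX P hP hPX p hp0 hp1 =>
    isMAPErrorExponent_mapExponent hX hP hPX hp0 hp1, ?_, fun hprime =>
    cubicExponent_mapExponent hL fun q hq => exists_moment_ne hprime hq, fun h12 heven => ?_⟩
  -- The dichotomy is whether moments of order at most 3 separate all shift classes.
  · by_cases h : ∀ q ∈ inequivPairs L,
      ∃ A : Finset (ZMod L), A.card < 4 ∧ moment A q.1 ≠ moment A q.2
    · exact Or.inl (cubicExponent_mapExponent hL h)
    · push Not at h
      obtain ⟨q, hq, h⟩ := h
      exact Or.inr (quarticExponent_mapExponent hq h)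
  · obtain ⟨m, hm⟩ := heven
    exact quarticExponent_mapExponent
      (chiralAntiperiodic_mem_inequivPairs (m := m) (by omega) (by omega)) fun A hA =>
      moment_reflect_chiralAntiperiodic (by omega) (by omega) hA
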